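/- For $\tau\in\mathbf C\smallsetminus\{0\}$ let $$\varphi(z)=-\pi z-\frac{\pi}{4z}+\frac{\frac12+2\pi i\tau^{-2}}{2}\log(1-iz),\qquad P(z,\tau)=z^3+\Bigl(i-\frac1{4\pi}-\frac{i}{\tau^2}\Bigr)z^2-\frac z4-\frac i4 .$$ A saddle point (for $\tau$) is a point $z\ne0$, $z\neq -i$, with $\varphi'(z)=0$ (for any local branch of the logarithm); for $\tau^2\ne-4\pi i$ these are exactly the zeros of $P(\cdot,\tau)$. The nonzero ramification points are the $\tau\ne0$ for which $P(\cdot,\tau)$ and $\partial_zP(\cdot,\tau)$ have a common zero. There is a ramification point $\rho_3\approx-0.633938+0.010142i$ with $|\rho_3|\approx0.634019$ (the real part, the imaginary part and the modulus agree with the given decimals up to an error less than $5\cdot10^{-7}$), and every ramification point other than $\pm\rho_3$ has modulus larger than $|\rho_3|$. There are functions $Q_1,Q_2$ with the following properties. (a) For $0<|\tau|\le|\rho_3|$ the numbers $q_1(\tau)=\frac{i}{\tau^2}Q_1(\tau)$ and $q_2(\tau)=\frac{i\tau}{2}Q_2(\tau)$ are saddle points and zeros of $P(\cdot,\tau)$.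 (b) $Q_1$ and $Q_2$ are continuous on the closed disk $|\tau|\le|\rho_3|$; $Q_1$ is analytic at each point of this disk other than $\pm\rho_3$, and $Q_2$ at each point other than $-\rho_3$. The Taylor series of $Q_1$ and of $Q_2$ at $0$ both have radius of convergence exactly $|\rho_3|$ and represent these functions for $|\tau|<|\rho_3|$. (c) As $\tau\to0$, $$Q_1(\tau)=1+\Bigl(-1-\frac{i}{4\pi}\Bigr)\tau^2-\frac{\tau^4}{4}-\frac{(8\pi+i)\tau^6}{16\pi}+O(\tau^7),$$ $$Q_2(\tau)=1+\frac{\tau}{4}+\Bigl(\frac{17}{32}+\frac{i}{8\pi}\Bigr)\tau^2+\Bigl(\frac12+\frac{i}{16\pi}\Bigr)\tau^3+O(\tau^4).$$ (d) $Q_1(\tau)\neq0$ and $Q_2(\tau)\ne0$ for all $|\tau|\le|\rho_3|$. (e) For every $\varepsilon>0$ there is $\tau_0>0$ such that for all real $\tau$ with $0<\tau<\tau_0$, $$1-\varepsilon<|Q_1(\tau)|\le1,\qquad 1\le|Q_2(\tau)|\le1+\varepsilon .$$ -/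

import Mathlib

open Complex Filter Topology Asymptotics Polynomial

/-- The phase `φ(z) = -π z - π / (4 z) + (1/2) (1/2 + 2 π i τ⁻²) log (1 - i z)`, where `L` is the
chosen branch of `log (1 - i z)`. -/
noncomputable def phase (L : ℂ → ℂ) (τ z : ℂ) : ℂ :=
  -(Real.pi : ℂ) * z - (Real.pi : ℂ) / (4 * z)
    + (1 / 2 + 2 * (Real.pi : ℂ) * I / τ ^ 2) / 2 * L z

/-- `z` is a saddle point of the phase with parameter `τ`: `z ≠ 0`, and `φ'(z) = 0` for a
differentiable local branch `L` of `log (1 - i w)` near `z`. (Such branches differ by constants, so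
the choice of the branch does not matter; its existence means that `1 - i z ≠ 0`.) -/
def IsSaddlePoint (τ z : ℂ) : Prop :=
  z ≠ 0 ∧ ∃ L : ℂ → ℂ, DifferentiableAt ℂ L z ∧ (∀ᶠ w in 𝓝 z, exp (L w) = 1 - I * w) ∧
    HasDerivAt (phase L τ) 0 z

/-- The cubic `P(z, τ) = z³ + (i - 1/(4π) - i τ⁻²) z² - z/4 - i/4`, as a polynomial in `z`. -/
noncomputable def saddlePoly (τ : ℂ) : ℂ[X] :=
  X ^ 3 + C (I - 1 / (4 * (Real.pi : ℂ)) - I / τ ^ 2) * X ^ 2 - C (1 / 4) * X - C (I / 4)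

/-- The finite nonzero ramification points of the algebraic function defined by `P(z, τ) = 0`: the
`τ ≠ 0` for which `P(·, τ)` and its derivative in `z` have a common zero (that is, for which their
resultant vanishes). -/
def IsRamificationPoint (τ : ℂ) : Prop :=
  τ ≠ 0 ∧ ∃ z : ℂ, (saddlePoly τ).IsRoot z ∧ (saddlePoly τ).derivative.IsRoot z

/-- The saddle points are the zeros of `P(·, τ)`. For `τ ^ 2 = -4πi` the logarithm drops out of the
phase and `P(·, τ)` has the extra zero `-i`. -/
theorem isSaddlePoint_iff (τ z : ℂ) (hτ : τ ≠ 0) (hτ' : τ ^ 2 ≠ -4 * (Real.pi : ℂ) * I) :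
    IsSaddlePoint τ z ↔ (saddlePoly τ).IsRoot z := by
  have hπ : (Real.pi : ℂ) ≠ 0 := by exact_mod_cast Real.pi_ne_zero
  have hder : ∀ L : ℂ → ℂ, z ≠ 0 → HasDerivAt L (-I / (1 - I * z)) z →
      HasDerivAt (phase L τ) (-(Real.pi : ℂ) + (Real.pi : ℂ) / (4 * z ^ 2)
        + (1 / 2 + 2 * (Real.pi : ℂ) * I / τ ^ 2) / 2 * (-I / (1 - I * z))) z := by
    intro L hz hL
    have h1 : HasDerivAt (fun w : ℂ => -(Real.pi : ℂ) * w) (-(Real.pi : ℂ)) z := by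
      simpa using (hasDerivAt_id z).const_mul (-(Real.pi : ℂ))
    have h2 : HasDerivAt (fun w : ℂ => (Real.pi : ℂ) / (4 * w)) (-((Real.pi : ℂ) / (4 * z ^ 2))) z := by
      have := (hasDerivAt_inv hz).const_mul ((Real.pi : ℂ) / 4)
      have e : (fun w : ℂ => (Real.pi : ℂ) / (4 * w)) = fun w => (Real.pi : ℂ) / 4 * w⁻¹ := by
        funext w
        rw [div_mul_eq_div_div, div_eq_mul_inv]
      rw [e]
      exact this.congr_deriv (by field_simp)
    have h3 := (h1.sub h2).add
      (hL.const_mul ((1 / 2 + 2 * (Real.pi : ℂ) * I / τ ^ 2) / 2))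
    exact h3.congr_deriv (by ring)
  have halg : z ≠ 0 → 1 - I * z ≠ 0 → (-(Real.pi : ℂ) + (Real.pi : ℂ) / (4 * z ^ 2)
        + (1 / 2 + 2 * (Real.pi : ℂ) * I / τ ^ 2) / 2 * (-I / (1 - I * z)) = 0 ↔
        (saddlePoly τ).IsRoot z) := by
    intro hz hz'
    have key : (-(Real.pi : ℂ) + (Real.pi : ℂ) / (4 * z ^ 2)
        + (1 / 2 + 2 * (Real.pi : ℂ) * I / τ ^ 2) / 2 * (-I / (1 - I * z)))
        = (saddlePoly τ).eval z * (I * (Real.pi : ℂ) / (z ^ 2 * (1 - I * z))) := by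
      simp only [saddlePoly, eval_add, eval_sub, eval_mul, eval_pow, eval_X, eval_C]
      obtain ⟨w, hw⟩ : ∃ w, w = 1 - I * z := ⟨_, rfl⟩
      rw [← hw] at hz' ⊢
      field_simp
      rw [hw]
      ring_nf
      simp only [I_sq]
      ring
    rw [key, IsRoot.def, mul_eq_zero, or_iff_left]
    exact div_ne_zero (mul_ne_zero I_ne_zero hπ) (mul_ne_zero (pow_ne_zero 2 hz) hz')
  constructor
  · rintro ⟨hz, L, hL, hexp, hd⟩
    have hz' : 1 - I * z ≠ 0 := by
      rw [← hexp.self_of_nhds]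
      exact exp_ne_zero _
    have e1 := hL.hasDerivAt.cexp
    have e2 : HasDerivAt (fun w : ℂ => 1 - I * w) (-I) z := by
      simpa using ((hasDerivAt_id z).const_mul I).const_sub 1
    have e3 := e1.unique (e2.congr_of_eventuallyEq hexp)
    rw [hexp.self_of_nhds] at e3
    have e4 : HasDerivAt L (-I / (1 - I * z)) z := by
      have : deriv L z = -I / (1 - I * z) := by
        rw [eq_div_iff hz', mul_comm]
        exact e3
      rw [← this]
      exact hL.hasDerivAt
    exact (halg hz hz').1 ((hder L hz e4).unique hd)
  · intro hr
    have hP : (saddlePoly τ).eval z = 0 := hr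
    simp only [saddlePoly, eval_add, eval_sub, eval_mul, eval_pow, eval_X, eval_C] at hP
    have hz : z ≠ 0 := by
      rintro rfl
      simp at hP
    have hz' : 1 - I * z ≠ 0 := by
      intro h
      have hzI : z = -I := by linear_combination I * h + z * I_sq
      apply hτ'
      rw [hzI] at hP
      field_simp at hP
      ring_nf at hP
      have hI3 : I ^ 3 = -I := by rw [pow_succ, I_sq]; ring
      simp only [I_sq, hI3] at hP
      linear_combination hP
    refine ⟨hz, ?_⟩
    have e2 : HasDerivAt (fun w : ℂ => (1 - I * w) / (1 - I * z)) (-I / (1 - I * z)) z := by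
      have : HasDerivAt (fun w : ℂ => 1 - I * w) (-I) z := by
        simpa using ((hasDerivAt_id z).const_mul I).const_sub 1
      exact this.div_const _
    have e3 : HasDerivAt (fun w : ℂ => log ((1 - I * w) / (1 - I * z)) + log (1 - I * z))
        (-I / (1 - I * z)) z := by
      have := (e2.clog (by rw [div_self hz']; exact one_mem_slitPlane)).add_const
        (log (1 - I * z))
      simpa [div_self hz'] using this
    refine ⟨_, e3.differentiableAt, ?_, ?_⟩
    · have hc : ContinuousAt (fun w : ℂ => 1 - I * w) z := by fun_prop
      filter_upwards [hc.eventually_ne hz'] with w hw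
      rw [exp_add, exp_log (div_ne_zero hw hz'), exp_log hz', div_mul_cancel₀ _ hz']
    · have := hder _ hz e3
      rwa [(halg hz hz').2 hr] at this

/-! ### The critical value -/

/-! Put `z = i/x`. The saddle point equation becomes `x = τ² den x`, so `1/τ² = den x / x`, and the
critical points of the right side satisfy `2x³ + x² = 4`. The proof rests on the positive one,
`critInv`, with critical value `critVal = 1/ρ²`. On the circle `|x| = critInv` the modulus of `den x
/ x` is strictly largest at `x = critInv` (`norm_den_lt`), so for `|τ| ≤ |ρ|` a root can lie on this
circle only if `τ = ±ρ`. Inside the closed disk roots are unique: distinct roots `x`, `y` would give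
`4 = xy + x²y + xy²`, whereas the right side has modulus at most `critInv² + 2 critInv³ = 4`, with
equality to `4` only for `x = y = critInv` (`eq_critInv_of_critical`). Continuation from `τ = 0`
gives existence (`exists_inv_root`), and `Q₁ = 1/den x`.

Put `z = iτX/2` for the other saddle points. Removing the root already found leaves a quadratic in
`X` whose roots are `±1` at `τ = 0`. An estimate keeps them off the imaginary axis for `|τ| ≤ |ρ|`,
so exactly one stays in the right half plane (`discriminant_neg`); this is `Q₂`. It can collide with
the first root only where `x = critInv`, and `Re ρ < 0` then leaves only `τ = -ρ`.

Simple roots are analytic in `τ`; at a collision uniqueness and compactness still give continuity.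
There the defining polynomial is critical in the unknown but not in `τ`, which excludes an analytic
extension and fixes the radius of convergence. The other two critical points have critical values of
smaller modulus, hence ramification points of larger modulus. -/

theorem exists_critInv : ∃ x : ℝ, 0 < x ∧ 2 * x ^ 3 + x ^ 2 = 4 := by
  have hc : ContinuousOn (fun x : ℝ => 2 * x ^ 3 + x ^ 2) (Set.Icc 1 2) := by fun_prop
  obtain ⟨x, hx, h⟩ := intermediate_value_Icc (by norm_num) hc
    (show (4 : ℝ) ∈ Set.Icc _ _ by norm_num)
  exact ⟨x, by linarith [hx.1], h⟩

/-- The positive root of `2 x³ + x² = 4`, the reciprocal of the positive critical point of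
`u + 1 / (4 u) + 1 / (4 u²)`. -/
noncomputable def critInv : ℝ := exists_critInv.choose

theorem critInv_pos : 0 < critInv := exists_critInv.choose_spec.1

theorem critInv_eq : 2 * critInv ^ 3 + critInv ^ 2 = 4 := exists_critInv.choose_spec.2

theorem lt_critInv {y : ℝ} (h : 2 * y ^ 3 + y ^ 2 < 4) : y < critInv := by
  by_contra! hle
  have h1 := pow_le_pow_left₀ critInv_pos.le hle 3
  have h2 := pow_le_pow_left₀ critInv_pos.le hle 2
  linarith [critInv_eq]

theorem critInv_lt {y : ℝ} (hy : 0 ≤ y) (h : 4 < 2 * y ^ 3 + y ^ 2) : critInv < y := by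
  by_contra! hle
  have h1 := pow_le_pow_left₀ hy hle 3
  have h2 := pow_le_pow_left₀ hy hle 2
  linarith [critInv_eq]

theorem critInv_bounds : 1.11338619006 < critInv ∧ critInv < 1.11338619007 :=
  ⟨lt_critInv (by norm_num), critInv_lt (by norm_num) (by norm_num)⟩

/-- The imaginary part `1 / (4 π)` of the shift. -/
noncomputable def shiftIm : ℝ := 1 / (4 * Real.pi)

theorem shiftIm_bounds : 0.0795774715 < shiftIm ∧ shiftIm < 0.0795774716 := by
  have h1 := Real.pi_gt_d20
  have h2 := Real.pi_lt_d20
  unfold shiftIm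
  rw [lt_div_iff₀ (by positivity), div_lt_iff₀ (by positivity)]
  constructor <;> linarith

/-- The real part of the critical value. -/
noncomputable def critRe : ℝ := 1 + critInv / 2 + 3 * critInv ^ 2 / 4

theorem critRe_bounds : 2.4864147011 < critRe ∧ critRe < 2.4864147014 := by
  obtain ⟨h1, h2⟩ := critInv_bounds
  unfold critRe
  constructor <;> nlinarith

/-- The shift `1 + i / (4 π)`. -/
noncomputable def shift : ℂ := 1 + shiftIm * I

theorem shift_eq : shift = 1 + I / (4 * (Real.pi : ℂ)) := by
  unfold shift shiftIm
  push_cast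
  ring

theorem norm_shift_le : ‖shift‖ ≤ 1.0032 := by
  have h := shiftIm_bounds
  have : ‖shift‖ ^ 2 = 1 + shiftIm ^ 2 := by
    rw [← normSq_eq_norm_sq, normSq_apply]
    simp [shift, pow_two]
  refine abs_le_of_sq_le_sq' ?_ (by norm_num) |>.2
  rw [this]
  nlinarith

/-- The critical value. -/
noncomputable def critVal : ℂ := critRe + shiftIm * I

theorem exists_sq_mul_eq_one : ∃ ρ : ℂ, ρ ^ 2 * critVal = 1 ∧ ρ.re < 0 := by
  have hpos := critRe_bounds.1
  have h0 : critVal ≠ 0 := by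
    intro h
    have := congrArg re h
    simp [critVal] at this
    linarith
  obtain ⟨z, hz⟩ := IsAlgClosed.exists_pow_nat_eq critVal⁻¹ (n := 2) (by norm_num)
  have hz1 : z ^ 2 * critVal = 1 := by rw [hz, inv_mul_cancel₀ h0]
  rcases lt_trichotomy z.re 0 with h | h | h
  · exact ⟨z, hz1, h⟩
  -- A purely imaginary root would make `z²` real, although `critVal` is not real.
  · exfalso
    have e1 := congrArg re hz1
    have e2 := congrArg im hz1
    simp [critVal, pow_two, h] at e1 e2
    rcases e2 with e2 | e2
    · simp [e2] at e1
    · linarith [shiftIm_bounds.1]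
  · exact ⟨-z, by simpa using hz1, by simpa using h⟩

/-- The ramification point nearest to the origin, in the left half plane. -/
noncomputable def rho : ℂ := exists_sq_mul_eq_one.choose

theorem rho_sq_mul : rho ^ 2 * critVal = 1 := exists_sq_mul_eq_one.choose_spec.1

theorem rho_re_neg : rho.re < 0 := exists_sq_mul_eq_one.choose_spec.2

theorem normSq_rho_sq_mul : ((rho.re ^ 2 + rho.im ^ 2) ^ 2) * (critRe ^ 2 + shiftIm ^ 2) = 1 := by
  have := congrArg normSq rho_sq_mul
  rw [map_mul, map_pow, normSq_apply, normSq_apply] at this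
  simp [critVal] at this
  linear_combination this

theorem normSq_rho_bounds :
    0.4019797 < rho.re ^ 2 + rho.im ^ 2 ∧ rho.re ^ 2 + rho.im ^ 2 < 0.4019797003 := by
  obtain ⟨h1, h2⟩ := critRe_bounds
  obtain ⟨h3, h4⟩ := shiftIm_bounds
  have h := normSq_rho_sq_mul
  set m := rho.re ^ 2 + rho.im ^ 2
  have hm : 0 ≤ m := by positivity
  have hn1 : 6.188590639 < critRe ^ 2 + shiftIm ^ 2 := by nlinarith
  have hn2 : critRe ^ 2 + shiftIm ^ 2 < 6.188590643 := by nlinarith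
  constructor
  · by_contra! hle
    have := pow_le_pow_left₀ hm hle 2
    nlinarith
  · by_contra! hle
    have := pow_le_pow_left₀ (by norm_num) hle 2
    nlinarith

theorem norm_rho_sq : ‖rho‖ ^ 2 = rho.re ^ 2 + rho.im ^ 2 := by
  rw [← normSq_eq_norm_sq, normSq_apply]
  ring

/-- Since `ρ² = 1/critVal`, this gives `Re ρ²` and `Im ρ²` without division. The coordinates of `ρ`
then follow from `2 (Re ρ)² = |ρ|² + Re ρ²` and `2 Re ρ Im ρ = Im ρ²`. -/
theorem rho_sq_eq : rho ^ 2 = (‖rho‖ ^ 4 : ℝ) * (starRingEnd ℂ critVal) := by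
  have h1 : (‖rho‖ ^ 4 : ℝ) * ‖critVal‖ ^ 2 = 1 := by
    have := congrArg norm rho_sq_mul
    rw [norm_mul, norm_pow, norm_one] at this
    linear_combination (‖rho‖ ^ 2 * ‖critVal‖ + 1) * this
  have h2 : critVal * (starRingEnd ℂ critVal) = (‖critVal‖ ^ 2 : ℝ) := by
    rw [mul_conj, normSq_eq_norm_sq]
  have h3 : ((‖rho‖ ^ 4 : ℝ) : ℂ) * (‖critVal‖ ^ 2 : ℝ) = 1 := by exact_mod_cast h1
  linear_combination (-rho ^ 2) * h3 + rho ^ 2 * (‖rho‖ ^ 4 : ℝ) * h2.symm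
    - (-(‖rho‖ ^ 4 : ℝ) * (starRingEnd ℂ critVal)) * rho_sq_mul

theorem rho_re_bounds : -0.63393758 < rho.re ∧ rho.re < -0.63393755 := by
  have h := congrArg re rho_sq_eq
  rw [re_ofReal_mul] at h
  simp [critVal, pow_two] at h
  have h4 : ‖rho‖ ^ 4 = (rho.re ^ 2 + rho.im ^ 2) ^ 2 := by rw [← norm_rho_sq]; ring
  rw [h4] at h
  obtain ⟨h1, h2⟩ := critRe_bounds
  obtain ⟨h5, h6⟩ := normSq_rho_bounds
  have h3 := rho_re_neg
  set m := rho.re ^ 2 + rho.im ^ 2 with hm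
  have hp : rho.re ^ 2 = (m + critRe * m ^ 2) / 2 := by linear_combination h / 2 - hm / 2
  have hm1 : 0.16158767 < m ^ 2 := by nlinarith
  have hm2 : m ^ 2 < 0.161587680 := by nlinarith
  have hp1 : rho.re ^ 2 < 0.63393758 ^ 2 := by rw [hp]; nlinarith
  have hp2 : 0.63393755 ^ 2 < rho.re ^ 2 := by rw [hp]; nlinarith
  constructor
  · nlinarith
  · nlinarith

theorem rho_im_bounds : 0.0101418 < rho.im ∧ rho.im < 0.0101421 := by
  have h := congrArg im rho_sq_eq
  rw [im_ofReal_mul] at h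
  simp [critVal, pow_two] at h
  have h4 : ‖rho‖ ^ 4 = (rho.re ^ 2 + rho.im ^ 2) ^ 2 := by rw [← norm_rho_sq]; ring
  rw [h4] at h
  obtain ⟨h1, h2⟩ := rho_re_bounds
  obtain ⟨h3, h4⟩ := shiftIm_bounds
  obtain ⟨h5, h6⟩ := normSq_rho_bounds
  set m := rho.re ^ 2 + rho.im ^ 2
  have hm1 : 0.1615876 < m ^ 2 := by nlinarith
  have hm2 : m ^ 2 < 0.1615877 := by nlinarith
  have hB1 : 0.012858 < m ^ 2 * shiftIm := by nlinarith
  have hB2 : m ^ 2 * shiftIm < 0.012859 := by nlinarith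
  constructor
  · nlinarith
  · nlinarith

theorem norm_rho_bounds : 0.63401868 < ‖rho‖ ∧ ‖rho‖ < 0.6340187 := by
  obtain ⟨h1, h2⟩ := normSq_rho_bounds
  rw [← norm_rho_sq] at h1 h2
  have := norm_nonneg rho
  constructor <;> nlinarith

theorem rho_ne_zero : rho ≠ 0 := by
  intro h
  have := rho_re_neg
  simp [h] at this

/-! ### The critical circle -/

/-- The denominator `1 + a x + x² / 4 + x³ / 4`: in the variable `x` with `z = i / x`, the saddle
point equation is `x = τ² (1 + a x + x² / 4 + x³ / 4)`. -/
noncomputable def den (x : ℂ) : ℂ := 1 + shift * x + x ^ 2 / 4 + x ^ 3 / 4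

theorem critInv_eq' : 2 * (critInv : ℂ) ^ 3 + (critInv : ℂ) ^ 2 = 4 := by
  exact_mod_cast critInv_eq

theorem critInv_ne_zero : (critInv : ℂ) ≠ 0 := by exact_mod_cast critInv_pos.ne'

theorem den_critInv : den critInv = critInv * critVal := by
  simp only [den, shift, critVal, critRe]
  push_cast
  linear_combination -critInv_eq' / 4

theorem rho_sq_mul_den : rho ^ 2 * den critInv = critInv := by
  rw [den_critInv]
  linear_combination (critInv : ℂ) * rho_sq_mul

/-- With `x = critInv (c + s i)` the left side is `|den x / x|²` and the right side `|critVal|²`.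
Their difference is divisible by `1 - c`, and in the quotient the term `-2 critRe E` dominates with
much room. -/
theorem critical_circle_inequality {c s : ℝ} (hcs : c ^ 2 + s ^ 2 = 1) (hc : c < 1) :
    (critRe - (1 - c) * (critInv / 2 + critInv ^ 2 / 2 + critInv ^ 2 * (1 + c) / 2)) ^ 2
      + (shiftIm - s * critInv ^ 2 * (1 - c) / 2) ^ 2 < critRe ^ 2 + shiftIm ^ 2 := by
  obtain ⟨b1, b2⟩ := critInv_bounds
  obtain ⟨b3, b4⟩ := critRe_bounds
  obtain ⟨b5, b6⟩ := shiftIm_bounds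
  have hw1 : 1.239 < critInv ^ 2 := by nlinarith
  have hw2 : critInv ^ 2 < 1.24 := by nlinarith
  set w := critInv ^ 2
  have hc' : -1 ≤ c := by nlinarith
  set E : ℝ := critInv / 2 + w / 2 + w * (1 + c) / 2 with hE
  have ht : 0 < 1 - c := by linarith
  have hE1 : 1.17 ≤ E := by
    have : 0 ≤ w * (1 + c) := mul_nonneg (by linarith) (by linarith)
    linarith
  have hE2 : (1 - c) * E ≤ 2.4 := by
    have e1 : E ≤ 1.177 + 0.62 * (1 + c) := by
      have := mul_le_mul_of_nonneg_right hw2.le (show 0 ≤ 1 + c by linarith)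
      linarith
    have e2 := mul_le_mul_of_nonneg_left e1 ht.le
    nlinarith [sq_nonneg (c + 1)]
  have hs1 : -1 ≤ s := by nlinarith
  have hs2 : s ^ 2 * (1 - c) ≤ 1.2 := by
    have : s ^ 2 = (1 - c) * (1 + c) := by linear_combination hcs
    rw [this]
    -- On `[-1, 1]` the maximum of `(1 - c)² (1 + c)` is `32/27`, attained at `c = -1/3`; hence the
    -- squares of `3c + 1`.
    nlinarith [mul_nonneg (show 0 ≤ 1 + c by linarith) (sq_nonneg (3 * c + 1)),
      mul_nonneg ht.le (sq_nonneg (3 * c + 1))]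
  have k1 : shiftIm * w ≤ 0.1 := by nlinarith
  have k0 : 0 ≤ shiftIm * w := mul_nonneg (by linarith) (by linarith)
  have k2 : -(s * (shiftIm * w)) ≤ 0.1 := by nlinarith
  have k3 : s ^ 2 * (1 - c) * w ^ 2 / 4 ≤ 0.48 := by
    have h1 : w ^ 2 ≤ 1.6 := by nlinarith
    have h2 : 0 ≤ s ^ 2 * (1 - c) := mul_nonneg (sq_nonneg s) ht.le
    have := mul_le_mul hs2 h1 (sq_nonneg w) (by norm_num)
    linarith
  have k4 : (1 - c) * E * E ≤ 2.4 * E := mul_le_mul_of_nonneg_right hE2 (by linarith)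
  have k5 : 2.48 * E ≤ critRe * E := mul_le_mul_of_nonneg_right (by linarith) (by linarith)
  have key : -2 * critRe * E + (1 - c) * E * E - s * (shiftIm * w)
      + s ^ 2 * (1 - c) * w ^ 2 / 4 < 0 := by linarith
  have := mul_pos_of_neg_of_neg key (show -(1 - c) < 0 by linarith)
  linarith [show (critRe - (1 - c) * E) ^ 2 + (shiftIm - s * w * (1 - c) / 2) ^ 2
    = critRe ^ 2 + shiftIm ^ 2 - (-2 * critRe * E + (1 - c) * E * E - s * (shiftIm * w)
      + s ^ 2 * (1 - c) * w ^ 2 / 4) * -(1 - c) by ring]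

theorem norm_den_lt {x : ℂ} (hx : ‖x‖ = critInv) (hne : x ≠ critInv) :
    ‖den x‖ < ‖den critInv‖ := by
  have hpos := critInv_pos
  obtain ⟨c, s, hxc⟩ : ∃ c s : ℝ, x = critInv * (c + s * I) :=
    ⟨x.re / critInv, x.im / critInv, by
      push_cast
      have := critInv_ne_zero
      field_simp
      exact (re_add_im x).symm⟩
  have hcs : c ^ 2 + s ^ 2 = 1 := by
    have h1 : ‖x‖ ^ 2 = critInv ^ 2 * (c ^ 2 + s ^ 2) := by
      rw [← normSq_eq_norm_sq, hxc, normSq_mul, normSq_ofReal, normSq_add_mul_I]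
      ring
    rw [hx] at h1
    have : critInv ^ 2 * (c ^ 2 + s ^ 2 - 1) = 0 := by linear_combination -h1
    rcases mul_eq_zero.1 this with h | h
    · exact absurd h (by positivity)
    · linarith
  have hc : c < 1 := by
    rcases lt_or_ge c 1 with h | h
    · exact h
    · have hs : s = 0 := by nlinarith
      have hc1 : c = 1 := by nlinarith
      exact absurd (by rw [hxc, hs, hc1]; simp) hne
  have hc' : -1 ≤ c := by nlinarith
  set E : ℝ := critInv / 2 + critInv ^ 2 / 2 + critInv ^ 2 * (1 + c) / 2 with hE
  have hcsC : (c : ℂ) ^ 2 + (s : ℂ) ^ 2 = 1 := by exact_mod_cast hcs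
  have key : den x = x * (((critRe - (1 - c) * E : ℝ) : ℂ)
      + ((shiftIm - s * critInv ^ 2 * (1 - c) / 2 : ℝ) : ℂ) * I) := by
    -- By the cubic equation `1/critInv = critInv/4 + critInv²/2`, so this expresses `1/x` as a
    -- polynomial in `critInv`, `c` and `s`.
    have e1 : x * (((critInv : ℂ) / 4 + (critInv : ℂ) ^ 2 / 2) * (c - s * I)) = 1 := by
      rw [hxc]
      linear_combination (critInv : ℂ) * (critInv / 4 + critInv ^ 2 / 2) * (hcsC - s ^ 2 * I_sq)
        + critInv_eq' / 4
    have e2 : ((critInv : ℂ) / 4 + (critInv : ℂ) ^ 2 / 2) * (c - s * I) + shift + x / 4 + x ^ 2 / 4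
        = ((critRe - (1 - c) * E : ℝ) : ℂ)
          + ((shiftIm - s * critInv ^ 2 * (1 - c) / 2 : ℝ) : ℂ) * I := by
      rw [hxc, hE, critRe, shift]
      push_cast
      linear_combination (critInv : ℂ) ^ 2 * s ^ 2 / 4 * I_sq - (critInv : ℂ) ^ 2 / 4 * hcsC
    rw [← e2, den]
    linear_combination -e1
  have h1 : ‖den x‖ ^ 2 = critInv ^ 2 * ((critRe - (1 - c) * E) ^ 2
      + (shiftIm - s * critInv ^ 2 * (1 - c) / 2) ^ 2) := by
    rw [key, norm_mul, mul_pow, hx, ← normSq_eq_norm_sq, normSq_add_mul_I]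
  have h2 : ‖den critInv‖ ^ 2 = critInv ^ 2 * (critRe ^ 2 + shiftIm ^ 2) := by
    rw [den_critInv, norm_mul, mul_pow, norm_real, Real.norm_eq_abs, sq_abs, critVal,
      ← normSq_eq_norm_sq, normSq_add_mul_I]
  refine lt_of_pow_lt_pow_left₀ 2 (norm_nonneg _) ?_
  rw [h1, h2]
  refine mul_lt_mul_of_pos_left ?_ (by positivity)
  exact critical_circle_inequality hcs hc

/-! ### Analytic selection of roots -/

theorem exists_analytic_implicit {N : ℂ × ℂ → ℂ} {t x c : ℂ} (hN : AnalyticAt ℂ N (t, x))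
    (h0 : N (t, x) = 0) (hc : HasDerivAt (fun y => N (t, y)) c x) (hc0 : c ≠ 0) :
    ∃ g : ℂ → ℂ, AnalyticAt ℂ g t ∧ g t = x ∧ (∀ᶠ s in 𝓝 t, N (s, g s) = 0) ∧
      ∀ᶠ v in 𝓝 (t, x), N v = 0 → v.2 = g v.1 := by
  have hN' : ContDiffAt ℂ ⊤ N (t, x) := hN.contDiffAt
  have hinv : (fderiv ℂ N (t, x) ∘L .inr ℂ ℂ ℂ).IsInvertible := by
    have h1 : HasDerivAt (fun y => N (t, y)) (fderiv ℂ N (t, x) (0, 1)) x :=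
      (hN.differentiableAt.hasFDerivAt).comp_hasDerivAt x
        ((hasDerivAt_const x t).prodMk (hasDerivAt_id x))
    have h2 := h1.unique hc
    refine ⟨ContinuousLinearEquiv.unitsEquivAut ℂ (Units.mk0 c hc0), ?_⟩
    ext
    simp [h2]
  have hT : (⊤ : WithTop ℕ∞) ≠ 0 := by simp
  refine ⟨hN'.implicitFunction hT hinv, (hN'.contDiffAt_implicitFunction hT hinv).analyticAt,
    hN'.implicitFunction_apply_self hT hinv, ?_, ?_⟩
  · simpa [h0] using hN'.eventually_apply_implicitFunction hT hinv
  · filter_upwards [hN'.eventually_apply_eq_iff_implicitFunction hT hinv] with v hv hv0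
    exact (hv.1 (by rw [hv0, h0])).symm

/-- Compactness: outside a neighbourhood of `x` the slice of `S` over `t` misses `K`, and by
closedness the nearby slices miss it too. No implicit function theorem is needed, so this also
covers the branch points. -/
theorem tendsto_of_unique_in_closed {S : Set (ℂ × ℂ)} (hS : IsClosed S) {K : Set ℂ}
    (hK : IsCompact K) {l : Filter ℂ} {f : ℂ → ℂ} {t x : ℂ} (hl : l ≤ 𝓝 t)
    (hf : ∀ᶠ s in l, f s ∈ K ∧ (s, f s) ∈ S) (hu : ∀ y, (t, y) ∈ S → y = x) :
    Tendsto f l (𝓝 x) := by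
  rw [tendsto_nhds]
  intro U hU hx
  have h1 : ∀ᶠ s in 𝓝 t, ∀ y ∈ K \ U, (s, y) ∉ S := by
    refine (hK.diff hU).eventually_forall_of_forall_eventually fun y hy => ?_
    refine hS.isOpen_compl.mem_nhds fun hmem => hy.2 ?_
    rwa [hu y hmem]
  filter_upwards [hl h1, hf] with s hs hfs
  by_contra hn
  exact hs _ ⟨hfs.1, hn⟩ hfs.2

/-- A root selected in a region `T`, unique in a closed region `S` containing `T`, depends
analytically on the parameter where it is simple and interior to `T`. -/
theorem analyticAt_of_unique_root {N : ℂ × ℂ → ℂ} (hNc : Continuous N) {t c : ℂ} {f : ℂ → ℂ}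
    (hN : AnalyticAt ℂ N (t, f t)) (h0 : N (t, f t) = 0)
    (hc : HasDerivAt (fun y => N (t, y)) c (f t)) (hc0 : c ≠ 0)
    {S T : Set (ℂ × ℂ)} (hS : IsClosed S) (hTS : T ⊆ S) (hT : T ∈ 𝓝 (t, f t))
    {K : Set ℂ} (hK : IsCompact K) (hTK : ∀ v ∈ T, v.2 ∈ K)
    (hu : ∀ y, (t, y) ∈ S → N (t, y) = 0 → y = f t)
    (hf : ∀ s, (∃ y, (s, y) ∈ T ∧ N (s, y) = 0) → (s, f s) ∈ T ∧ N (s, f s) = 0) :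
    AnalyticAt ℂ f t := by
  obtain ⟨g, hg, hgt, hg0, hgu⟩ := exists_analytic_implicit hN h0 hc hc0
  have h1 : Tendsto (fun s => (s, g s)) (𝓝 t) (𝓝 (t, f t)) := by
    have := tendsto_id.prodMk_nhds hg.continuousAt.tendsto
    rwa [hgt] at this
  -- The implicit root stays in `T`, so a root is available for selection at nearby parameters.
  -- Uniqueness over `t` then makes `f` continuous at `t`, and local uniqueness identifies it with
  -- `g`.
  have h2 : ∀ᶠ s in 𝓝 t, (s, f s) ∈ T ∧ N (s, f s) = 0 := by
    filter_upwards [h1 hT, hg0] with s hs hs0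
    exact hf s ⟨g s, hs, hs0⟩
  have h3 : Tendsto f (𝓝 t) (𝓝 (f t)) :=
    tendsto_of_unique_in_closed (hS.inter (isClosed_eq hNc continuous_const)) hK le_rfl
      (h2.mono fun s hs => ⟨hTK _ hs.1, hTS hs.1, hs.2⟩) fun y hy => hu y hy.1 hy.2
  have h4 : Tendsto (fun s => (s, f s)) (𝓝 t) (𝓝 (t, f t)) := tendsto_id.prodMk_nhds h3
  refine hg.congr ?_
  filter_upwards [h4.eventually hgu, h2] with s hs hs2
  exact (hs hs2.2).symm

/-- A power series representing `f` on a disk has no larger radius of convergence, if `f` satisfies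
an equation `N (t, f t) = 0` and `N` has a critical zero in the second variable on the boundary that
is not critical in the first. -/
theorem radius_le_of_critical_boundary_root {N : ℂ × ℂ → ℂ} (hN : AnalyticOnNhd ℂ N Set.univ)
    {f : ℂ → ℂ} {p : FormalMultilinearSeries ℂ ℂ ℂ} {r : ℝ} {t c : ℂ} (hr : 0 < r)
    (hp : HasFPowerSeriesOnBall f p 0 (ENNReal.ofReal r)) (ht : ‖t‖ = r)
    (hf : ContinuousOn f (Metric.closedBall 0 r)) (hN0 : ∀ s, ‖s‖ < r → N (s, f s) = 0)
    (h2 : HasDerivAt (fun y => N (t, y)) 0 (f t))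
    (h1 : HasDerivAt (fun s => N (s, f t)) c t) (hc : c ≠ 0) :
    p.radius ≤ ENNReal.ofReal r := by
  by_contra! hlt
  have hpos : 0 < p.radius := lt_of_le_of_lt bot_le hlt
  have hg := p.hasFPowerSeriesOnBall hpos
  set g := p.sum
  have hball : Metric.ball (0 : ℂ) r = Metric.eball 0 (ENNReal.ofReal r) :=
    (Metric.eball_ofReal).symm
  have htb : t ∈ Metric.eball (0 : ℂ) p.radius := by
    refine lt_of_le_of_lt ?_ hlt
    rw [edist_zero_right, ← ofReal_norm, ht]
  have hfg : ∀ s, ‖s‖ < r → f s = g s := by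
    intro s hs
    have hs' : s ∈ Metric.eball (0 : ℂ) (ENNReal.ofReal r) := by
      rw [← hball]; simpa using hs
    have := hp.sum hs'
    simpa using this
  have hga := hg.analyticOnNhd
  have htc : t ∈ closure (Metric.ball (0 : ℂ) r) := by
    rw [closure_ball _ hr.ne']
    simp [ht]
  have hft : f t = g t := by
    have c1 : ContinuousWithinAt f (Metric.ball 0 r) t :=
      (hf t (by simp [ht])).mono Metric.ball_subset_closedBall
    have c2 : ContinuousWithinAt g (Metric.ball 0 r) t :=
      (hga t htb).continuousAt.continuousWithinAt
    have : (𝓝[Metric.ball 0 r] t).NeBot := mem_closure_iff_nhdsWithin_neBot.1 htc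
    refine tendsto_nhds_unique c1 (c2.congr' ?_)
    filter_upwards [self_mem_nhdsWithin] with s hs
    exact (hfg s (by simpa using hs)).symm
  -- By the identity theorem the equation persists on the larger disk and can be differentiated at
  -- `t`. The chain rule gives `∂₁N + g'(t) ∂₂N = 0`; as `∂₂N = 0` there, `∂₁N = c` would vanish.
  have hcomp : AnalyticOnNhd ℂ (fun s => N (s, g s)) (Metric.eball 0 p.radius) := fun s hs =>
    AnalyticAt.comp (g := N) (f := fun s => (s, g s)) (hN _ trivial)
      (analyticAt_id.prod (hga s hs))
  have hzero : Set.EqOn (fun s => N (s, g s)) 0 (Metric.eball 0 p.radius) := by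
    refine hcomp.eqOn_zero_of_preconnected_of_eventuallyEq_zero (z₀ := 0)
      ?_ (Metric.mem_eball_self hpos) ?_
    · exact (convex_eball _ _).isPreconnected
    · filter_upwards [Metric.ball_mem_nhds (0 : ℂ) hr] with s hs
      have hs' : ‖s‖ < r := by simpa using hs
      simpa [← hfg s hs'] using hN0 s hs'
  have hder : HasDerivAt (fun s => N (s, g s)) 0 t := by
    refine (hasDerivAt_const t (0 : ℂ)).congr_of_eventuallyEq ?_
    filter_upwards [Metric.isOpen_eball.mem_nhds htb] with s hs using hzero hs
  have hNd := (hN (t, g t) trivial).differentiableAt.hasFDerivAt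
  rw [hft] at h1 h2
  have d := hNd.comp_hasDerivAt t ((hasDerivAt_id t).prodMk (hga t htb).differentiableAt.hasDerivAt)
  have d1 := hNd.comp_hasDerivAt t ((hasDerivAt_id t).prodMk (hasDerivAt_const t (g t)))
  have d2 := hNd.comp_hasDerivAt (g t)
    ((hasDerivAt_const (g t) t).prodMk (hasDerivAt_id (g t)))
  have e := d.unique hder
  have e1 := d1.unique h1
  have e2 := d2.unique h2
  have hsplit : ((1 : ℂ), deriv g t) = (1, 0) + deriv g t • ((0 : ℂ), (1 : ℂ)) := by simp
  rw [hsplit, map_add, map_smul, e1, e2, smul_zero, add_zero] at e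
  exact hc e

/-! ### The root `x` of `x = τ² den x` in the critical disk -/

/-- The cofactor is a divided difference: on the diagonal it equals `den x - x den' x`, so its zeros
detect both coinciding values and critical points of `x / den x`. -/
theorem mul_den_sub_mul_den (x y : ℂ) :
    x * den y - y * den x = (x - y) * (1 - x * y / 4 - x * y * (x + y) / 4) := by
  simp only [den]
  ring

theorem eq_ofReal_of_norm_le_of_re_eq {z : ℂ} {R : ℝ} (h : ‖z‖ ≤ R) (hre : z.re = R) : z = R := by
  have h1 : z.re ^ 2 + z.im ^ 2 ≤ R ^ 2 := by
    have := pow_le_pow_left₀ (norm_nonneg z) h 2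
    rw [← normSq_eq_norm_sq, normSq_apply] at this
    linarith
  rw [hre] at h1
  have h2 : z.im = 0 := by nlinarith
  exact Complex.ext (by simp [hre]) (by simp [h2])

/-- Equality case of the triangle inequality: three terms of moduli at most `critInv²`, `critInv³`,
`critInv³` add up to `4`, the sum of these bounds, so each equals its bound. -/
theorem eq_critInv_of_critical {x y : ℂ} (hx : ‖x‖ ≤ critInv) (hy : ‖y‖ ≤ critInv)
    (h : 1 - x * y / 4 - x * y * (x + y) / 4 = 0) : x = critInv ∧ y = critInv := by
  have hpos := critInv_pos.le
  have n1 : ‖x * y‖ ≤ critInv ^ 2 := by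
    rw [norm_mul, pow_two]
    exact mul_le_mul hx hy (norm_nonneg _) hpos
  have n2 : ‖x * y * x‖ ≤ critInv ^ 3 := by
    rw [norm_mul, pow_succ]
    exact mul_le_mul n1 hx (norm_nonneg _) (by positivity)
  have n3 : ‖x * y * y‖ ≤ critInv ^ 3 := by
    rw [norm_mul, pow_succ]
    exact mul_le_mul n1 hy (norm_nonneg _) (by positivity)
  have hsum : x * y + x * y * x + x * y * y = 4 := by linear_combination -4 * h
  have hre : (x * y).re + (x * y * x).re + (x * y * y).re = 4 := by
    have := congrArg re hsum
    simpa only [add_re, re_ofNat] using this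
  have l1 := (re_le_norm _).trans n1
  have l2 := (re_le_norm _).trans n2
  have l3 := (re_le_norm _).trans n3
  have hc := critInv_eq
  have e1 := eq_ofReal_of_norm_le_of_re_eq n1 (by linarith)
  have e2 := eq_ofReal_of_norm_le_of_re_eq n2 (by linarith)
  have e3 := eq_ofReal_of_norm_le_of_re_eq n3 (by linarith)
  have h0 : ((critInv ^ 2 : ℝ) : ℂ) ≠ 0 := by
    exact_mod_cast (pow_pos critInv_pos 2).ne'
  constructor
  · apply mul_left_cancel₀ h0
    rw [← e1, e2, e1]
    push_cast
    ring
  · apply mul_left_cancel₀ h0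
    rw [← e1, e3, e1]
    push_cast
    ring

theorem eq_of_eq_mul_den {t x y : ℂ} (hx : ‖x‖ ≤ critInv) (hy : ‖y‖ ≤ critInv)
    (ex : x = t * den x) (ey : y = t * den y) : x = y := by
  have h : (x - y) * (1 - x * y / 4 - x * y * (x + y) / 4) = 0 := by
    rw [← mul_den_sub_mul_den]
    linear_combination den y * ex - den x * ey
  rcases mul_eq_zero.1 h with h | h
  · exact sub_eq_zero.1 h
  · obtain ⟨h1, h2⟩ := eq_critInv_of_critical hx hy h
    rw [h1, h2]

theorem den_ne_zero {t x : ℂ} (h : x = t * den x) : den x ≠ 0 := by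
  intro h0
  rw [h0, mul_zero] at h
  simp [h, den] at h0

theorem hasDerivAt_den (x : ℂ) : HasDerivAt den (shift + x / 2 + 3 * x ^ 2 / 4) x := by
  have h := ((((hasDerivAt_id x).const_mul shift).const_add 1).add
    ((hasDerivAt_pow 2 x).div_const 4)).add ((hasDerivAt_pow 3 x).div_const 4)
  exact h.congr_deriv (by norm_num; ring)

/-- Multiplied by `den x`, the derivative becomes `den x - x den' x`, the diagonal case of the
cofactor. -/
theorem one_sub_mul_deriv_den_ne_zero {t x : ℂ} (hx : ‖x‖ ≤ critInv) (hne : x ≠ critInv)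
    (h : x = t * den x) : 1 - t * (shift + x / 2 + 3 * x ^ 2 / 4) ≠ 0 := by
  intro h0
  refine hne (eq_critInv_of_critical hx hx ?_).1
  have : den x * (1 - t * (shift + x / 2 + 3 * x ^ 2 / 4)) = 0 := by rw [h0, mul_zero]
  have e : den x = 1 + shift * x + x ^ 2 / 4 + x ^ 3 / 4 := rfl
  linear_combination this + (shift + x / 2 + 3 * x ^ 2 / 4) * -h - e

theorem eq_critInv_of_norm_eq {τ x : ℂ} (hτ : ‖τ‖ ≤ ‖rho‖) (hx : ‖x‖ = critInv)
    (h : x = τ ^ 2 * den x) : x = critInv ∧ τ ^ 2 = rho ^ 2 := by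
  have hxc : x = critInv := by
    by_contra hne
    have h1 := norm_den_lt hx hne
    have h2 : critInv = ‖τ‖ ^ 2 * ‖den x‖ := by
      rw [← norm_pow, ← norm_mul, ← h, hx]
    have h3 : critInv = ‖rho‖ ^ 2 * ‖den critInv‖ := by
      rw [← norm_pow, ← norm_mul, rho_sq_mul_den, norm_real, Real.norm_of_nonneg critInv_pos.le]
    have h4 : 0 < ‖rho‖ ^ 2 := by have := rho_ne_zero; positivity
    have h5 : ‖τ‖ ^ 2 ≤ ‖rho‖ ^ 2 := pow_le_pow_left₀ (norm_nonneg _) hτ 2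
    nlinarith [norm_nonneg (den x)]
  refine ⟨hxc, ?_⟩
  have h0 := den_ne_zero h
  rw [hxc] at h h0
  exact mul_right_cancel₀ h0 (by rw [← h, rho_sq_mul_den])

theorem norm_lt_critInv {τ x : ℂ} (hτ : ‖τ‖ ≤ ‖rho‖) (hne : τ ^ 2 ≠ rho ^ 2)
    (hx : ‖x‖ ≤ critInv) (h : x = τ ^ 2 * den x) : ‖x‖ < critInv :=
  lt_of_le_of_ne hx fun hc => hne (eq_critInv_of_norm_eq hτ hc h).2

theorem sq_ne_rho_sq_of_norm_lt {τ : ℂ} (hτ : ‖τ‖ < ‖rho‖) : τ ^ 2 ≠ rho ^ 2 := by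
  intro h
  rcases sq_eq_sq_iff_eq_or_eq_neg.1 h with h | h <;> simp [h] at hτ

/-- The equation for `x`. -/
noncomputable def invEq (v : ℂ × ℂ) : ℂ := v.2 - v.1 ^ 2 * den v.2

theorem analyticOnNhd_invEq : AnalyticOnNhd ℂ invEq Set.univ := by
  have h : ContDiff ℂ ⊤ invEq := by
    unfold invEq den
    fun_prop
  exact fun v _ => h.contDiffAt.analyticAt

theorem continuous_invEq : Continuous invEq :=
  continuousOn_univ.1 analyticOnNhd_invEq.continuousOn

theorem invEq_eq_zero {τ x : ℂ} : invEq (τ, x) = 0 ↔ x = τ ^ 2 * den x := sub_eq_zero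

theorem hasDerivAt_invEq (τ x : ℂ) :
    HasDerivAt (fun y => invEq (τ, y)) (1 - τ ^ 2 * (shift + x / 2 + 3 * x ^ 2 / 4)) x :=
  (hasDerivAt_id x).sub ((hasDerivAt_den x).const_mul (τ ^ 2))

/-- Continuity method on the open disk: the parameters with a root in the open critical disk form an
open set by the implicit function theorem. It is relatively closed because limits of roots exist by
compactness and cannot lie on the critical circle. A last limit reaches the boundary. -/
theorem exists_inv_root {τ : ℂ} (hτ : ‖τ‖ ≤ ‖rho‖) :
    ∃ x : ℂ, ‖x‖ ≤ critInv ∧ x = τ ^ 2 * den x := by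
  set u : Set ℂ := {s | s ∈ Metric.ball (0 : ℂ) ‖rho‖ ∧ ∃ x : ℂ, ‖x‖ < critInv ∧
    x = s ^ 2 * den x} with hu
  set C : Set (ℂ × ℂ) := (Metric.closedBall 0 ‖rho‖ ×ˢ Metric.closedBall 0 critInv) ∩
    {v | invEq v = 0} with hC
  have hCc : IsCompact C := ((isCompact_closedBall _ _).prod (isCompact_closedBall _ _)).inter_right
    (isClosed_eq continuous_invEq continuous_const)
  have hD : IsClosed (Prod.fst '' C) := (hCc.image continuous_fst).isClosed
  have huC : u ⊆ Prod.fst '' C := by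
    rintro s ⟨hs, x, hx, h⟩
    exact ⟨(s, x), ⟨⟨Metric.ball_subset_closedBall hs, by simpa using hx.le⟩,
      invEq_eq_zero.2 h⟩, rfl⟩
  have huo : IsOpen u := by
    rw [isOpen_iff_mem_nhds]
    rintro s ⟨hs, x, hx, h⟩
    have hne : x ≠ critInv := by
      rintro rfl
      simp [abs_of_pos critInv_pos] at hx
    obtain ⟨g, hg, hgs, hg0, -⟩ := exists_analytic_implicit (analyticOnNhd_invEq (s, x) trivial)
      (invEq_eq_zero.2 h) (hasDerivAt_invEq s x) (one_sub_mul_deriv_den_ne_zero hx.le hne h)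
    have h1 : ∀ᶠ w in 𝓝 s, ‖g w‖ < critInv :=
      hg.continuousAt.norm.eventually_lt continuousAt_const (by simpa [hgs] using hx)
    filter_upwards [Metric.isOpen_ball.mem_nhds hs, h1, hg0] with w hw hw1 hw0
    exact ⟨hw, g w, hw1, invEq_eq_zero.1 hw0⟩
  have hpos : 0 < ‖rho‖ := norm_pos_iff.2 rho_ne_zero
  have hball : Metric.ball (0 : ℂ) ‖rho‖ ⊆ u := by
    refine (convex_ball (0 : ℂ) ‖rho‖).isPreconnected.subset_of_closure_inter_subset huo ?_ ?_
    · refine ⟨0, Metric.mem_ball_self hpos, Metric.mem_ball_self hpos, 0, ?_, ?_⟩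
      · simpa using critInv_pos
      · simp
    · rintro s ⟨hs, hsb⟩
      obtain ⟨⟨s', x⟩, ⟨⟨-, hx⟩, h⟩, rfl⟩ := closure_minimal huC hD hs
      have hs' : ‖s'‖ < ‖rho‖ := by simpa using hsb
      exact ⟨hsb, x, norm_lt_critInv hs'.le (sq_ne_rho_sq_of_norm_lt hs') (by simpa using hx)
        (invEq_eq_zero.1 h), invEq_eq_zero.1 h⟩
  have hτ' : τ ∈ closure (Metric.ball (0 : ℂ) ‖rho‖) := by
    rw [closure_ball _ hpos.ne']
    simpa using hτ
  obtain ⟨⟨s, x⟩, ⟨⟨-, hx⟩, h⟩, rfl⟩ := closure_minimal (hball.trans huC) hD hτ'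
  exact ⟨x, by simpa using hx, invEq_eq_zero.1 h⟩

open Classical in
/-- The root of `x = τ² den x` in the critical disk. -/
noncomputable def invRoot (τ : ℂ) : ℂ :=
  if h : ∃ x : ℂ, ‖x‖ ≤ critInv ∧ x = τ ^ 2 * den x then h.choose else 0

/-- Analyticity at a boundary point of the disk involves parameters beyond it, so the hypothesis is
the existence of a root and not a bound on `τ`. -/
theorem invRoot_spec_of_exists {τ : ℂ} (h : ∃ x : ℂ, ‖x‖ ≤ critInv ∧ x = τ ^ 2 * den x) :
    ‖invRoot τ‖ ≤ critInv ∧ invRoot τ = τ ^ 2 * den (invRoot τ) := by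
  unfold invRoot
  rw [dif_pos h]
  exact h.choose_spec

theorem norm_invRoot_le {τ : ℂ} (hτ : ‖τ‖ ≤ ‖rho‖) : ‖invRoot τ‖ ≤ critInv :=
  (invRoot_spec_of_exists (exists_inv_root hτ)).1

theorem invRoot_eq {τ : ℂ} (hτ : ‖τ‖ ≤ ‖rho‖) : invRoot τ = τ ^ 2 * den (invRoot τ) :=
  (invRoot_spec_of_exists (exists_inv_root hτ)).2

theorem eq_invRoot {τ x : ℂ} (hx : ‖x‖ ≤ critInv) (h : x = τ ^ 2 * den x) : x = invRoot τ := by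
  have := invRoot_spec_of_exists ⟨x, hx, h⟩
  exact eq_of_eq_mul_den hx this.1 h this.2

theorem invRoot_zero : invRoot 0 = 0 := by
  simpa using invRoot_eq (τ := 0) (by simp)

theorem invRoot_eq_critInv {τ : ℂ} (h : τ ^ 2 = rho ^ 2) : invRoot τ = critInv := by
  refine (eq_invRoot ?_ ?_).symm
  · simp [abs_of_pos critInv_pos]
  · rw [h, rho_sq_mul_den]

theorem invRoot_ne_critInv {τ : ℂ} (hτ : ‖τ‖ ≤ ‖rho‖) (hne : τ ^ 2 ≠ rho ^ 2) :
    invRoot τ ≠ critInv := by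
  intro h
  have := norm_lt_critInv hτ hne (norm_invRoot_le hτ) (invRoot_eq hτ)
  simp [h, abs_of_pos critInv_pos] at this

theorem continuousOn_invRoot : ContinuousOn invRoot (Metric.closedBall 0 ‖rho‖) := by
  intro τ hτ
  refine tendsto_of_unique_in_closed (S := (Set.univ ×ˢ Metric.closedBall 0 critInv) ∩
    {v | invEq v = 0}) ?_ (isCompact_closedBall 0 critInv) nhdsWithin_le_nhds ?_ ?_
  · exact (isClosed_univ.prod Metric.isClosed_closedBall).inter
      (isClosed_eq continuous_invEq continuous_const)
  · filter_upwards [self_mem_nhdsWithin] with s hs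
    have hs' : ‖s‖ ≤ ‖rho‖ := by simpa using hs
    have := norm_invRoot_le hs'
    exact ⟨by simpa using this, ⟨trivial, by simpa using this⟩, invEq_eq_zero.2 (invRoot_eq hs')⟩
  · rintro y ⟨⟨-, hy⟩, h⟩
    exact eq_invRoot (by simpa using hy) (invEq_eq_zero.1 h)

theorem analyticAt_invRoot {τ : ℂ} (hτ : ‖τ‖ ≤ ‖rho‖) (hne : τ ^ 2 ≠ rho ^ 2) :
    AnalyticAt ℂ invRoot τ := by
  have hT : IsClosed (Set.univ ×ˢ Metric.closedBall 0 critInv : Set (ℂ × ℂ)) :=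
    isClosed_univ.prod Metric.isClosed_closedBall
  have hlt := norm_lt_critInv hτ hne (norm_invRoot_le hτ) (invRoot_eq hτ)
  refine analyticAt_of_unique_root continuous_invEq (analyticOnNhd_invEq _ trivial)
    (invEq_eq_zero.2 (invRoot_eq hτ)) (hasDerivAt_invEq τ _)
    (one_sub_mul_deriv_den_ne_zero (norm_invRoot_le hτ) (invRoot_ne_critInv hτ hne)
      (invRoot_eq hτ)) hT subset_rfl ?_ (isCompact_closedBall 0 critInv) (fun v hv => hv.2) ?_ ?_
  · exact prod_mem_nhds univ_mem (Metric.closedBall_mem_nhds_of_mem (by simpa using hlt))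
  · rintro y ⟨-, hy⟩ h
    exact eq_invRoot (by simpa using hy) (invEq_eq_zero.1 h)
  · rintro s ⟨y, ⟨-, hy⟩, h⟩
    obtain ⟨h1, h2⟩ := invRoot_spec_of_exists ⟨y, by simpa using hy, invEq_eq_zero.1 h⟩
    exact ⟨⟨trivial, by simpa using h1⟩, invEq_eq_zero.2 h2⟩

/-- The function `Q₁`. -/
noncomputable def firstFactor (τ : ℂ) : ℂ := (den (invRoot τ))⁻¹

theorem continuousOn_firstFactor : ContinuousOn firstFactor (Metric.closedBall 0 ‖rho‖) := by
  refine ContinuousOn.inv₀ ?_ fun τ hτ => den_ne_zero (invRoot_eq (by simpa using hτ))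
  have hd : Continuous den := by unfold den; fun_prop
  exact hd.comp_continuousOn continuousOn_invRoot

theorem analyticAt_firstFactor {τ : ℂ} (hτ : ‖τ‖ ≤ ‖rho‖) (hne : τ ^ 2 ≠ rho ^ 2) :
    AnalyticAt ℂ firstFactor τ := by
  have h := analyticAt_invRoot hτ hne
  refine AnalyticAt.inv ?_ (den_ne_zero (invRoot_eq hτ))
  unfold den
  fun_prop

theorem firstFactor_ne_zero {τ : ℂ} (hτ : ‖τ‖ ≤ ‖rho‖) : firstFactor τ ≠ 0 :=
  inv_ne_zero (den_ne_zero (invRoot_eq hτ))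

theorem firstFactor_zero : firstFactor 0 = 1 := by
  simp [firstFactor, invRoot_zero, den]

theorem invRoot_mul_firstFactor {τ : ℂ} (hτ : ‖τ‖ ≤ ‖rho‖) :
    invRoot τ * firstFactor τ = τ ^ 2 := by
  have h := den_ne_zero (invRoot_eq hτ)
  rw [firstFactor, ← div_eq_mul_inv, div_eq_iff h]
  exact invRoot_eq hτ

/-- The equation for `Q₁`. -/
theorem firstFactor_eq {τ : ℂ} (hτ : ‖τ‖ ≤ ‖rho‖) :
    firstFactor τ ^ 3 + (shift * τ ^ 2 - 1) * firstFactor τ ^ 2 + τ ^ 4 * firstFactor τ / 4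
      + τ ^ 6 / 4 = 0 := by
  have h := invRoot_mul_firstFactor hτ
  have h1 : den (invRoot τ) * firstFactor τ = 1 := mul_inv_cancel₀ (den_ne_zero (invRoot_eq hτ))
  rw [show τ ^ 4 = (τ ^ 2) ^ 2 by ring, show τ ^ 6 = (τ ^ 2) ^ 3 by ring, ← h]
  unfold den at h1
  linear_combination firstFactor τ ^ 2 * h1

/-! ### The second root -/

/-- The equation for `Q₂`. -/
noncomputable def secondEq (v : ℂ × ℂ) : ℂ :=
  1 + v.1 * v.2 / 2 + shift * v.1 ^ 2 * v.2 ^ 2 + v.1 ^ 3 * v.2 ^ 3 / 2 - v.2 ^ 2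

theorem analyticOnNhd_secondEq : AnalyticOnNhd ℂ secondEq Set.univ := by
  have h : ContDiff ℂ ⊤ secondEq := by
    unfold secondEq
    fun_prop
  exact fun v _ => h.contDiffAt.analyticAt

theorem continuous_secondEq : Continuous secondEq :=
  continuousOn_univ.1 analyticOnNhd_secondEq.continuousOn

theorem hasDerivAt_secondEq (τ X : ℂ) : HasDerivAt (fun y => secondEq (τ, y))
    (τ / 2 + 2 * shift * τ ^ 2 * X + 3 * τ ^ 3 * X ^ 2 / 2 - 2 * X) X := by
  have h1 := (((hasDerivAt_id X).const_mul τ).div_const 2).const_add 1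
  have h2 := (hasDerivAt_pow 2 X).const_mul (shift * τ ^ 2)
  have h3 := ((hasDerivAt_pow 3 X).const_mul (τ ^ 3)).div_const 2
  exact (((h1.add h2).add h3).sub (hasDerivAt_pow 2 X)).congr_deriv (by norm_num; ring)

theorem hasDerivAt_secondEq_fst (τ X : ℂ) : HasDerivAt (fun s => secondEq (s, X))
    (X / 2 + 2 * shift * τ * X ^ 2 + 3 * τ ^ 2 * X ^ 3 / 2) τ := by
  have h1 := (((hasDerivAt_id τ).mul_const X).div_const 2).const_add 1
  have h2 := ((hasDerivAt_pow 2 τ).const_mul shift).mul_const (X ^ 2)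
  have h3 := ((hasDerivAt_pow 3 τ).mul_const (X ^ 3)).div_const 2
  refine (((h1.add h2).add h3).sub_const (X ^ 2)).congr_deriv ?_
  push_cast
  ring

/-- Half the sum of the two roots of the quadratic factor of `secondEq`. -/
noncomputable def halfSum (τ : ℂ) : ℂ := τ / 4 * (den (invRoot τ) * (1 + invRoot τ))

/-- The variables are related by `x = 2/(τX)`. The linear factor carries the root `invRoot τ`, which
goes to `X = ∞` as `τ → 0`; the quadratic factor stays regular there. -/
theorem secondEq_factor {τ : ℂ} (hτ : ‖τ‖ ≤ ‖rho‖) (X : ℂ) :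
    secondEq (τ, X) = (τ ^ 3 / 2 * X - firstFactor τ) *
      (X ^ 2 - 2 * halfSum τ * X - den (invRoot τ)) := by
  have h := invRoot_eq hτ
  have hd : firstFactor τ * den (invRoot τ) = 1 := inv_mul_cancel₀ (den_ne_zero h)
  have hx : invRoot τ * firstFactor τ = τ ^ 2 := invRoot_mul_firstFactor hτ
  have e : den (invRoot τ) = 1 + shift * invRoot τ + invRoot τ ^ 2 / 4 + invRoot τ ^ 3 / 4 := rfl
  unfold secondEq halfSum
  set x := invRoot τ
  set d := den x
  set y := firstFactor τ
  linear_combination -hd - τ / 2 * (1 + x) * X * hd - τ / 2 * X * h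
    + X ^ 2 * (-(τ ^ 2 * (1 + x) / 4) * h - (shift + x * (1 + x) / 4) * hx + hd - y * e)

/-- For `X = iy` and `w = |τX|` the equation forces `1 + y² ≤ w/2 + 1.0032 w² + w³/2`. This is
incompatible with `w² ≤ 0.402 y²` and `w ≤ 2/critInv < 1.8`. -/
theorem re_ne_zero_of_secondEq {τ X : ℂ} (hτ : ‖τ‖ ≤ ‖rho‖) (hX : ‖τ * X‖ * critInv ≤ 2)
    (h : secondEq (τ, X) = 0) : X.re ≠ 0 := by
  intro hre
  have hXy : X = X.im * I := by
    apply Complex.ext <;> simp [hre]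
  have h1 : 1 + X.im ^ 2 ≤ ‖τ * X‖ / 2 + 1.0032 * ‖τ * X‖ ^ 2 + ‖τ * X‖ ^ 3 / 2 := by
    have e : -((1 + X.im ^ 2 : ℝ) : ℂ)
        = τ * X / 2 + shift * (τ * X) ^ 2 + (τ * X) ^ 3 / 2 := by
      have : X ^ 2 = -((X.im ^ 2 : ℝ) : ℂ) := by
        conv_lhs => rw [hXy]
        rw [mul_pow, I_sq]
        push_cast
        ring
      unfold secondEq at h
      push_cast at this ⊢
      linear_combination -h - this
    have e2 := congrArg norm e
    rw [norm_neg, norm_real, Real.norm_of_nonneg (by positivity)] at e2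
    rw [e2]
    refine (norm_add₃_le).trans ?_
    simp only [norm_div, norm_mul, norm_pow, RCLike.norm_ofNat]
    gcongr
    exact norm_shift_le
  have h2 : ‖τ * X‖ ^ 2 = ‖τ‖ ^ 2 * X.im ^ 2 := by
    rw [norm_mul, mul_pow]
    conv_lhs => rw [hXy]
    simp
  have h3 : ‖τ‖ ^ 2 ≤ 0.402 := by
    have := norm_rho_bounds.2
    nlinarith [norm_nonneg τ]
  have h4 : ‖τ * X‖ ≤ 1.8 := by
    have := critInv_bounds.1
    nlinarith [norm_nonneg (τ * X)]
  set w := ‖τ * X‖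
  have h5 : w ^ 2 ≤ 0.402 * X.im ^ 2 := by
    rw [h2]
    gcongr
  have h6 : w ^ 3 ≤ 1.8 * w ^ 2 := by nlinarith [sq_nonneg w]
  nlinarith [sq_nonneg (w - 1)]

/-- A crude bound, used only to keep the selected root in a compact set. -/
theorem norm_lt_of_secondEq {τ X : ℂ} (hX : ‖τ * X‖ * critInv ≤ 2)
    (h : secondEq (τ, X) = 0) : ‖X‖ < 10 := by
  have h4 : ‖τ * X‖ ≤ 1.8 := by
    have := critInv_bounds.1
    nlinarith [norm_nonneg (τ * X)]
  have e : X ^ 2 = 1 + τ * X / 2 + shift * (τ * X) ^ 2 + (τ * X) ^ 3 / 2 := by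
    unfold secondEq at h
    linear_combination -h
  have h1 : ‖X‖ ^ 2 ≤ 1 + ‖τ * X‖ / 2 + 1.0032 * ‖τ * X‖ ^ 2 + ‖τ * X‖ ^ 3 / 2 := by
    rw [← norm_pow, e]
    refine (norm_add₄_le).trans ?_
    simp only [norm_div, norm_mul, norm_pow, RCLike.norm_ofNat, norm_one]
    gcongr
    exact norm_shift_le
  have h5 := pow_le_pow_left₀ (norm_nonneg (τ * X)) h4 2
  have h6 := pow_le_pow_left₀ (norm_nonneg (τ * X)) h4 3
  nlinarith [norm_nonneg X]

/-- Roots of the quadratic factor lie in the critical disk. -/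
theorem norm_mul_le_of_quadratic {τ X : ℂ} (hτ : ‖τ‖ ≤ ‖rho‖)
    (h : X ^ 2 - 2 * halfSum τ * X - den (invRoot τ) = 0) : ‖τ * X‖ * critInv ≤ 2 := by
  by_contra! hlt
  have h0 : secondEq (τ, X) = 0 := by rw [secondEq_factor hτ, h, mul_zero]
  have hne : τ * X ≠ 0 := by
    intro h
    simp [h] at hlt
    linarith
  have hτ0 : τ ≠ 0 := left_ne_zero_of_mul hne
  have hX0 : X ≠ 0 := right_ne_zero_of_mul hne
  have hx : ‖2 / (τ * X)‖ < critInv := by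
    rw [norm_div, div_lt_iff₀ (norm_pos_iff.2 hne), mul_comm]
    simpa using hlt
  have he : 2 / (τ * X) = τ ^ 2 * den (2 / (τ * X)) := by
    unfold den
    unfold secondEq at h0
    field_simp
    linear_combination (-8 : ℂ) * h0
  -- Now `X` is a root of the linear factor as well as of the quadratic one. So `invRoot τ` is a
  -- double root, hence `critInv`, which is not in the open disk.
  have h1 := eq_invRoot hx.le he
  have h2 : invRoot τ * (τ * X) = 2 := by rw [← h1]; exact div_mul_cancel₀ _ hne
  have hne' : invRoot τ ≠ critInv := by
    intro h
    rw [h1, h, norm_real, Real.norm_of_nonneg critInv_pos.le] at hx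
    exact lt_irrefl _ hx
  refine hne' (eq_critInv_of_critical (norm_invRoot_le hτ) (norm_invRoot_le hτ) ?_).1
  have e := invRoot_eq hτ
  have hd := den_ne_zero e
  unfold halfSum at h
  set x := invRoot τ
  linear_combination (x ^ 2 * τ ^ 2 * h - (x * (τ * X) + 2) * h2
    + x * (τ ^ 2 * den x) * (1 + x) / 2 * h2 - x * (1 + x) * e - x ^ 2 * e) / 4

/-- The right side is symmetric in `A` and `B`. For the roots of a quadratic it is therefore
continuous in the coefficients, with no need to label the roots continuously. -/
theorem mul_re_eq (A B : ℂ) :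
    A.re * B.re = ((A * B).re + (‖(A + B) / 2‖ ^ 2 - ‖((A - B) / 2) ^ 2‖)) / 2 := by
  rw [norm_pow, ← normSq_eq_norm_sq, ← normSq_eq_norm_sq, normSq_apply, normSq_apply]
  simp
  ring

theorem exists_roots_of_halfSum (τ : ℂ) : ∃ A B : ℂ, A + B = 2 * halfSum τ ∧
    A * B = -den (invRoot τ) ∧ ((A - B) / 2) ^ 2 = halfSum τ ^ 2 + den (invRoot τ) := by
  obtain ⟨w, hw⟩ := IsAlgClosed.exists_pow_nat_eq (halfSum τ ^ 2 + den (invRoot τ)) (n := 2)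
    (by norm_num)
  refine ⟨halfSum τ + w, halfSum τ - w, by ring, by linear_combination -hw,
    by linear_combination hw⟩

/-- The left side is `2 Re A Re B` for the roots `A`, `B` of the quadratic factor. It never vanishes
on the disk and is `-2` at `τ = 0`, where the roots are `±1`. -/
theorem discriminant_neg {τ : ℂ} (hτ : ‖τ‖ ≤ ‖rho‖) :
    (-den (invRoot τ)).re + (‖halfSum τ‖ ^ 2 - ‖halfSum τ ^ 2 + den (invRoot τ)‖) < 0 := by
  set m : ℂ → ℝ := fun τ =>
    (-den (invRoot τ)).re + (‖halfSum τ‖ ^ 2 - ‖halfSum τ ^ 2 + den (invRoot τ)‖) with hm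
  have hc : ContinuousOn m (Metric.closedBall 0 ‖rho‖) := by
    have hd : Continuous den := by unfold den; fun_prop
    have h1 : ContinuousOn (fun τ => den (invRoot τ)) (Metric.closedBall 0 ‖rho‖) :=
      hd.comp_continuousOn continuousOn_invRoot
    have h2 : ContinuousOn halfSum (Metric.closedBall 0 ‖rho‖) :=
      (continuousOn_id.div_const 4).mul
        (h1.mul (continuousOn_const.add continuousOn_invRoot))
    exact (continuous_re.comp_continuousOn h1.neg).add
      ((h2.norm.pow 2).sub ((h2.pow 2).add h1).norm)
  have hne : ∀ τ, ‖τ‖ ≤ ‖rho‖ → m τ ≠ 0 := by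
    intro τ hτ h0
    obtain ⟨A, B, hs, hp, hd⟩ := exists_roots_of_halfSum τ
    have h := mul_re_eq A B
    rw [hd, hs, hp, mul_div_cancel_left₀ _ two_ne_zero] at h
    have h0' : A.re * B.re = 0 := by
      rw [h]
      exact (div_eq_zero_iff).2 (Or.inl h0)
    have hroot : ∀ X, (X - A) * (X - B) = 0 → X.re ≠ 0 := by
      intro X hX
      have hq : X ^ 2 - 2 * halfSum τ * X - den (invRoot τ) = 0 := by
        linear_combination hX + X * hs - hp
      exact re_ne_zero_of_secondEq hτ (norm_mul_le_of_quadratic hτ hq)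
        (by rw [secondEq_factor hτ, hq, mul_zero])
    rcases mul_eq_zero.1 h0' with h | h
    · exact hroot A (by simp) h
    · exact hroot B (by simp) h
  by_contra! hle
  have hm0 : m 0 < 0 := by simp [hm, halfSum, invRoot_zero, den]
  obtain ⟨s, hs, hs0⟩ := (convex_closedBall (0 : ℂ) ‖rho‖).isPreconnected.intermediate_value
    (Metric.mem_closedBall_self (norm_nonneg _)) (show τ ∈ _ by simpa using hτ) hc
    ⟨hm0.le, hle⟩
  exact hne s (by simpa using hs) hs0

theorem exists_roots {τ : ℂ} (hτ : ‖τ‖ ≤ ‖rho‖) : ∃ A B : ℂ, 0 < A.re ∧ B.re < 0 ∧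
    ‖τ * A‖ * critInv ≤ 2 ∧
    ∀ X, secondEq (τ, X) = (τ ^ 3 / 2 * X - firstFactor τ) * ((X - A) * (X - B)) := by
  obtain ⟨A, B, hs, hp, hd⟩ := exists_roots_of_halfSum τ
  have h := mul_re_eq A B
  rw [hd, hs, hp, mul_div_cancel_left₀ _ two_ne_zero] at h
  have hq : ∀ X, X ^ 2 - 2 * halfSum τ * X - den (invRoot τ) = (X - A) * (X - B) := fun X => by
    linear_combination X * hs - hp
  have hneg : A.re * B.re < 0 := by linarith [discriminant_neg hτ]
  rcases mul_neg_iff.1 hneg with ⟨h1, h2⟩ | ⟨h1, h2⟩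
  · exact ⟨A, B, h1, h2, norm_mul_le_of_quadratic hτ (by rw [hq]; ring), fun X => by
      rw [secondEq_factor hτ, hq]⟩
  · exact ⟨B, A, h2, h1, norm_mul_le_of_quadratic hτ (by rw [hq]; ring), fun X => by
      rw [secondEq_factor hτ, hq]; ring⟩

/-- The closed region in which the root `Q₂` is selected. -/
def secondRegion : Set (ℂ × ℂ) :=
  {v | 0 ≤ v.2.re ∧ ‖v.1 * v.2‖ * critInv ≤ 2 ∧ ‖v.2‖ ≤ 10}

/-- The region in which the root `Q₂` is selected. -/
def secondRegionPos : Set (ℂ × ℂ) :=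
  {v | 0 < v.2.re ∧ ‖v.1 * v.2‖ * critInv ≤ 2 ∧ ‖v.2‖ ≤ 10}

theorem isClosed_secondRegion : IsClosed secondRegion := by
  have c1 : IsClosed {v : ℂ × ℂ | 0 ≤ v.2.re} := isClosed_le (by fun_prop) (by fun_prop)
  have c2 : IsClosed {v : ℂ × ℂ | ‖v.1 * v.2‖ * critInv ≤ 2} :=
    isClosed_le (by fun_prop) (by fun_prop)
  have c3 : IsClosed {v : ℂ × ℂ | ‖v.2‖ ≤ 10} := isClosed_le (by fun_prop) (by fun_prop)
  exact c1.inter (c2.inter c3)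

theorem secondRegionPos_subset : secondRegionPos ⊆ secondRegion := fun _ h => ⟨h.1.le, h.2⟩

theorem invRoot_mul_of_linear_root {τ X : ℂ} (hτ : ‖τ‖ ≤ ‖rho‖)
    (h : τ ^ 3 / 2 * X - firstFactor τ = 0) : τ ≠ 0 ∧ invRoot τ * (τ * X) = 2 := by
  have hx := invRoot_mul_firstFactor hτ
  have hd := firstFactor_ne_zero hτ
  have hτ0 : τ ≠ 0 := by
    rintro rfl
    simp [hd] at h
  refine ⟨hτ0, ?_⟩
  have : τ ^ 2 * (invRoot τ * (τ * X) - 2) = 0 := by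
    linear_combination 2 * invRoot τ * h + 2 * hx
  rcases mul_eq_zero.1 this with h | h
  · exact absurd h (pow_ne_zero 2 hτ0)
  · exact sub_eq_zero.1 h

theorem deriv_secondEq_of_factor {τ A B y X : ℂ}
    (hf : ∀ X, secondEq (τ, X) = (τ ^ 3 / 2 * X - y) * ((X - A) * (X - B))) :
    τ / 2 + 2 * shift * τ ^ 2 * X + 3 * τ ^ 3 * X ^ 2 / 2 - 2 * X
      = τ ^ 3 / 2 * ((X - A) * (X - B)) + (τ ^ 3 / 2 * X - y) * ((X - B) + (X - A)) := by
  have hder2 : HasDerivAt (fun y => secondEq (τ, y)) (τ ^ 3 / 2 * ((X - A) * (X - B))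
      + (τ ^ 3 / 2 * X - y) * ((X - B) + (X - A))) X := by
    rw [funext hf]
    have d1 := ((hasDerivAt_id X).const_mul (τ ^ 3 / 2)).sub_const y
    have d2 := ((hasDerivAt_id X).sub_const A).mul ((hasDerivAt_id X).sub_const B)
    exact (d1.mul d2).congr_deriv (by simp)
  exact (hasDerivAt_secondEq τ X).unique hder2

/-- With `P = τX = 2/critInv`, `X` times the derivative is `2 secondEq + (P³ - P - 4)/2`, and `P³ =
P + 4` is the equation of `critInv`. -/
theorem deriv_secondEq_eq_zero {τ X : ℂ} (h3 : critInv * (τ * X) = 2)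
    (h_eq : secondEq (τ, X) = 0) :
    τ / 2 + 2 * shift * τ ^ 2 * X + 3 * τ ^ 3 * X ^ 2 / 2 - 2 * X = 0 := by
  have hX0 : X ≠ 0 := by
    rintro rfl
    simp at h3
  have hc := critInv_eq'
  refine (mul_eq_zero.1 (?_ : X * _ = 0)).resolve_left hX0
  have hP : (τ * X) ^ 3 = τ * X + 4 := by
    have : (critInv : ℂ) ^ 3 * ((τ * X) ^ 3 - τ * X - 4) = 0 := by
      linear_combination ((critInv * (τ * X)) ^ 2 + 2 * (critInv * (τ * X)) + 4
        - critInv ^ 2) * h3 - 2 * hc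
    linear_combination (mul_eq_zero.1 this).resolve_left (pow_ne_zero 3 critInv_ne_zero)
  unfold secondEq at h_eq
  linear_combination 2 * h_eq + hP / 2

theorem eq_root_of_mem {τ A B X : ℂ} (hτ : ‖τ‖ ≤ ‖rho‖) (hB : B.re < 0)
    (hf : ∀ X, secondEq (τ, X) = (τ ^ 3 / 2 * X - firstFactor τ) * ((X - A) * (X - B)))
    (hX : (τ, X) ∈ secondRegion) (h : secondEq (τ, X) = 0) : X = A := by
  obtain ⟨h1, h2, -⟩ := hX
  simp only at h1 h2
  have hXB : X - B ≠ 0 := by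
    intro h0
    rw [sub_eq_zero.1 h0] at h1
    linarith
  have h_eq := h
  rw [hf] at h
  rcases mul_eq_zero.1 h with h | h
  · obtain ⟨hτ0, h3⟩ := invRoot_mul_of_linear_root hτ h
    have h4 : ‖invRoot τ‖ * ‖τ * X‖ = 2 := by
      rw [← norm_mul, h3]
      simp
    have h5 : ‖invRoot τ‖ = critInv := by
      refine le_antisymm (norm_invRoot_le hτ) ?_
      by_contra! hlt
      have : ‖invRoot τ‖ * ‖τ * X‖ < critInv * ‖τ * X‖ := by
        refine mul_lt_mul_of_pos_right hlt (norm_pos_iff.2 ?_)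
        intro h0
        simp [h0] at h4
      linarith
    have h6 := (eq_critInv_of_norm_eq hτ h5 (invRoot_eq hτ)).1
    rw [h6] at h3
    -- A root of the linear factor inside the region sits at the critical point, so it is a double
    -- root of the cubic and annihilates the quadratic factor too.
    have hzero := deriv_secondEq_eq_zero h3 h_eq
    rw [deriv_secondEq_of_factor hf, h, zero_mul, add_zero] at hzero
    rcases mul_eq_zero.1 hzero with h | h
    · exact absurd h (div_ne_zero (pow_ne_zero 3 hτ0) two_ne_zero)
    · exact sub_eq_zero.1 ((mul_eq_zero.1 h).resolve_right hXB)
  · exact sub_eq_zero.1 ((mul_eq_zero.1 h).resolve_right hXB)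

open Classical in
/-- The function `Q₂`. -/
noncomputable def secondFactor (τ : ℂ) : ℂ :=
  if h : ∃ X : ℂ, (τ, X) ∈ secondRegionPos ∧ secondEq (τ, X) = 0 then h.choose else 0

theorem secondFactor_spec_of_exists {τ : ℂ}
    (h : ∃ X : ℂ, (τ, X) ∈ secondRegionPos ∧ secondEq (τ, X) = 0) :
    (τ, secondFactor τ) ∈ secondRegionPos ∧ secondEq (τ, secondFactor τ) = 0 := by
  unfold secondFactor
  rw [dif_pos h]
  exact h.choose_spec

theorem secondFactor_spec {τ : ℂ} (hτ : ‖τ‖ ≤ ‖rho‖) :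
    (τ, secondFactor τ) ∈ secondRegionPos ∧ secondEq (τ, secondFactor τ) = 0 := by
  obtain ⟨A, B, hA, -, hn, hf⟩ := exists_roots hτ
  have h0 : secondEq (τ, A) = 0 := by rw [hf]; ring
  exact secondFactor_spec_of_exists ⟨A, ⟨hA, hn, (norm_lt_of_secondEq hn h0).le⟩, h0⟩

theorem eq_secondFactor {τ X : ℂ} (hτ : ‖τ‖ ≤ ‖rho‖) (hX : (τ, X) ∈ secondRegion)
    (h : secondEq (τ, X) = 0) : X = secondFactor τ := by
  obtain ⟨A, B, -, hB, -, hf⟩ := exists_roots hτ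
  obtain ⟨h1, h2⟩ := secondFactor_spec hτ
  rw [eq_root_of_mem hτ hB hf hX h, eq_root_of_mem hτ hB hf (secondRegionPos_subset h1) h2]

theorem continuousOn_secondFactor : ContinuousOn secondFactor (Metric.closedBall 0 ‖rho‖) := by
  intro τ hτ
  refine tendsto_of_unique_in_closed (S := secondRegion ∩ {v | secondEq v = 0}) ?_
    (isCompact_closedBall 0 10) nhdsWithin_le_nhds ?_ ?_
  · exact isClosed_secondRegion.inter (isClosed_eq continuous_secondEq continuous_const)
  · filter_upwards [self_mem_nhdsWithin] with s hs
    obtain ⟨h1, h2⟩ := secondFactor_spec (τ := s) (by simpa using hs)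
    exact ⟨by simpa using h1.2.2, secondRegionPos_subset h1, h2⟩
  · exact fun y hy => eq_secondFactor (by simpa using hτ) hy.1 hy.2

/-- Away from `-rho` the selected root stays off the critical circle. -/
theorem norm_mul_secondFactor_lt {τ : ℂ} (hτ : ‖τ‖ ≤ ‖rho‖) (hne : τ ≠ -rho) :
    ‖τ * secondFactor τ‖ * critInv < 2 := by
  obtain ⟨⟨h1, h2, -⟩, h0⟩ := secondFactor_spec hτ
  simp only at h1 h2
  refine lt_of_le_of_ne h2 fun h => hne ?_
  set X := secondFactor τ
  have hp : τ * X ≠ 0 := by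
    intro h0
    simp [h0] at h
  have hτ0 : τ ≠ 0 := left_ne_zero_of_mul hp
  have hX0 : X ≠ 0 := right_ne_zero_of_mul hp
  have hx : ‖2 / (τ * X)‖ = critInv := by
    rw [norm_div, div_eq_iff (norm_ne_zero_iff.2 hp), mul_comm, h]
    simp
  have he : 2 / (τ * X) = τ ^ 2 * den (2 / (τ * X)) := by
    unfold den
    unfold secondEq at h0
    field_simp
    linear_combination (-8 : ℂ) * h0
  obtain ⟨e1, e2⟩ := eq_critInv_of_norm_eq hτ hx he
  rcases sq_eq_sq_iff_eq_or_eq_neg.1 e2 with h | h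
  · exfalso
    rw [div_eq_iff hp, h] at e1
    -- If `τ = ρ`, then `ρX` is a positive real number, so `Re X` has the sign of `Re ρ`, contrary
    -- to the choice of the right half plane.
    have e3 : (rho * X) = ((2 / critInv : ℝ) : ℂ) := by
      have := critInv_ne_zero
      push_cast
      rw [eq_div_iff this, e1]
      ring
    have r1 := congrArg re e3
    have r2 := congrArg im e3
    rw [mul_re, ofReal_re] at r1
    rw [mul_im, ofReal_im] at r2
    have hpos : 0 < 2 / critInv := div_pos two_pos critInv_pos
    have hr := rho_re_neg
    have r3 : (rho.re ^ 2 + rho.im ^ 2) * X.re = 2 / critInv * rho.re := by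
      linear_combination rho.re * r1 + rho.im * r2
    have : 2 / critInv * rho.re < 0 := mul_neg_of_pos_of_neg hpos hr
    have : 0 ≤ (rho.re ^ 2 + rho.im ^ 2) * X.re := by positivity
    linarith
  · exact h

theorem deriv_secondEq_ne_zero {τ : ℂ} (hτ : ‖τ‖ ≤ ‖rho‖) (hne : τ ≠ -rho) :
    τ / 2 + 2 * shift * τ ^ 2 * secondFactor τ + 3 * τ ^ 3 * secondFactor τ ^ 2 / 2
      - 2 * secondFactor τ ≠ 0 := by
  obtain ⟨h1, h0⟩ := secondFactor_spec hτ
  have hlt := norm_mul_secondFactor_lt hτ hne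
  obtain ⟨A, B, -, hB, -, hf⟩ := exists_roots hτ
  have hA := eq_root_of_mem hτ hB hf (secondRegionPos_subset h1) h0
  rw [deriv_secondEq_of_factor hf, ← hA, sub_self, zero_mul, mul_zero, zero_add, add_zero]
  refine mul_ne_zero (fun h => ?_) fun h => ?_
  · have h3 := congrArg norm (invRoot_mul_of_linear_root hτ h).2
    rw [norm_mul, RCLike.norm_ofNat] at h3
    have := mul_le_mul_of_nonneg_right (norm_invRoot_le hτ) (norm_nonneg (τ * secondFactor τ))
    linarith
  · have h4 : 0 < (secondFactor τ).re := h1.1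
    rw [sub_eq_zero.1 h] at h4
    linarith

theorem analyticAt_secondFactor {τ : ℂ} (hτ : ‖τ‖ ≤ ‖rho‖) (hne : τ ≠ -rho) :
    AnalyticAt ℂ secondFactor τ := by
  obtain ⟨h1, h0⟩ := secondFactor_spec hτ
  refine analyticAt_of_unique_root continuous_secondEq (analyticOnNhd_secondEq _ trivial) h0
    (hasDerivAt_secondEq τ _) (deriv_secondEq_ne_zero hτ hne) isClosed_secondRegion
    secondRegionPos_subset ?_ (isCompact_closedBall 0 10) (fun v hv => by simpa using hv.2.2)
    (fun y => eq_secondFactor hτ) fun s => secondFactor_spec_of_exists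
  -- All three inequalities are strict at the selected root, the second because `τ ≠ -ρ`; so the
  -- region is a neighbourhood.
  have o1 : IsOpen {v : ℂ × ℂ | 0 < v.2.re} := isOpen_lt (by fun_prop) (by fun_prop)
  have o2 : IsOpen {v : ℂ × ℂ | ‖v.1 * v.2‖ * critInv < 2} :=
    isOpen_lt (by fun_prop) (by fun_prop)
  have o3 : IsOpen {v : ℂ × ℂ | ‖v.2‖ < 10} := isOpen_lt (by fun_prop) (by fun_prop)
  filter_upwards [o1.mem_nhds h1.1, o2.mem_nhds (norm_mul_secondFactor_lt hτ hne),
    o3.mem_nhds (norm_lt_of_secondEq h1.2.1 h0)] with v k1 k2 k3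
  exact ⟨k1, le_of_lt k2, le_of_lt k3⟩

theorem secondFactor_zero : secondFactor 0 = 1 := by
  refine (eq_secondFactor (by simp) ⟨?_, ?_, ?_⟩ ?_).symm <;> simp [secondEq]

theorem secondFactor_ne_zero {τ : ℂ} (hτ : ‖τ‖ ≤ ‖rho‖) : secondFactor τ ≠ 0 := by
  intro h
  have := (secondFactor_spec hτ).1.1
  simp [h] at this

/-- The critical point gives `X = -2/(critInv ρ)`. It has positive real part because `Re ρ < 0`, so
uniqueness identifies it with `Q₂(-ρ)`. -/
theorem critInv_mul_secondFactor_neg_rho : critInv * (-rho * secondFactor (-rho)) = 2 := by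
  have hc := critInv_ne_zero
  have hr := rho_ne_zero
  have hp := critInv_pos
  have hs : rho ^ 2 * den critInv = critInv := rho_sq_mul_den
  set X : ℂ := 2 / (critInv * -rho) with hX
  have h3 : critInv * (-rho * X) = 2 := by
    rw [hX]
    field_simp
  have h4 : -rho * X = ((2 / critInv : ℝ) : ℂ) := by
    push_cast
    rw [eq_div_iff hc]
    linear_combination h3
  have h0 : secondEq (-rho, X) = 0 := by
    have hP : -rho * X * critInv = 2 := by linear_combination h3
    have e : (critInv : ℂ) ^ 3 * secondEq (-rho, X) * rho ^ 2 = 0 := by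
      unfold den at hs
      unfold secondEq
      set P := -rho * X with hPdef
      have e1 : (1 + -rho * X / 2 + shift * (-rho) ^ 2 * X ^ 2 + (-rho) ^ 3 * X ^ 3 / 2 - X ^ 2)
          * rho ^ 2 = rho ^ 2 * (1 + P / 2 + shift * P ^ 2 + P ^ 3 / 2) - P ^ 2 := by
        rw [hPdef]; ring
      rw [mul_assoc, e1]
      have hPc : P = 2 / critInv := by rw [eq_div_iff hc]; exact hP
      rw [hPc]
      field_simp
      linear_combination 4 * hs
    rcases mul_eq_zero.1 e with h | h
    · exact (mul_eq_zero.1 h).resolve_left (pow_ne_zero 3 hc)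
    · exact absurd h (pow_ne_zero 2 hr)
  have hn : ‖-rho * X‖ * critInv ≤ 2 := by
    rw [h4, norm_real, Real.norm_of_nonneg (by positivity)]
    exact (div_mul_cancel₀ _ hp.ne').le
  have hre : 0 ≤ X.re := by
    have r1 := congrArg re h4
    have r2 := congrArg im h4
    simp only [mul_re, mul_im, ofReal_re, ofReal_im, neg_re, neg_im] at r1 r2
    have hr := rho_re_neg
    have r3 : (rho.re ^ 2 + rho.im ^ 2) * X.re = 2 / critInv * -rho.re := by
      linear_combination -rho.re * r1 - rho.im * r2
    have h5 : 0 < 2 / critInv * -rho.re := mul_pos (by positivity) (by linarith)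
    by_contra! hlt
    have : (rho.re ^ 2 + rho.im ^ 2) * X.re ≤ 0 :=
      mul_nonpos_of_nonneg_of_nonpos (by positivity) hlt.le
    linarith
  rw [← eq_secondFactor (by simp) ⟨hre, hn, (norm_lt_of_secondEq hn h0).le⟩ h0]
  exact h3

/-! ### Taylor series -/

theorem hasFPowerSeriesOnBall_cauchy {f : ℂ → ℂ}
    (hf : ContinuousOn f (Metric.closedBall 0 ‖rho‖))
    (ha : ∀ τ, ‖τ‖ < ‖rho‖ → AnalyticAt ℂ f τ) :
    HasFPowerSeriesOnBall f (cauchyPowerSeries f 0 ‖rho‖) 0 (ENNReal.ofReal ‖rho‖) := by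
  have hpos : 0 < ‖rho‖₊ := nnnorm_pos.2 rho_ne_zero
  have hd : DifferentiableOn ℂ f (Metric.ball 0 ‖rho‖₊) := fun τ hτ =>
    (ha τ (by simpa using hτ)).differentiableAt.differentiableWithinAt
  have hdc : DiffContOnCl ℂ f (Metric.ball 0 ‖rho‖₊) := by
    refine ⟨hd, hf.mono ?_⟩
    exact Metric.closure_ball_subset_closedBall
  have := hdc.hasFPowerSeriesOnBall hpos
  rwa [ofReal_norm]

theorem ne_of_norm_lt_rho {τ : ℂ} (h : ‖τ‖ < ‖rho‖) : τ ≠ -rho := by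
  rintro rfl
  simp at h

/-- The equation for `Q₁`. -/
noncomputable def firstEq (v : ℂ × ℂ) : ℂ :=
  v.2 ^ 3 + (shift * v.1 ^ 2 - 1) * v.2 ^ 2 + v.1 ^ 4 * v.2 / 4 + v.1 ^ 6 / 4

theorem analyticOnNhd_firstEq : AnalyticOnNhd ℂ firstEq Set.univ := by
  have h : ContDiff ℂ ⊤ firstEq := by
    unfold firstEq
    fun_prop
  exact fun v _ => h.contDiffAt.analyticAt

theorem exists_firstFactor_series : ∃ p : FormalMultilinearSeries ℂ ℂ ℂ,
    HasFPowerSeriesOnBall firstFactor p 0 (ENNReal.ofReal ‖rho‖) ∧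
      p.radius = ENNReal.ofReal ‖rho‖ := by
  have hp := hasFPowerSeriesOnBall_cauchy continuousOn_firstFactor fun τ hτ =>
    analyticAt_firstFactor hτ.le (sq_ne_rho_sq_of_norm_lt hτ)
  refine ⟨_, hp, le_antisymm ?_ hp.r_le⟩
  have hx := invRoot_eq_critInv (τ := rho) rfl
  have hxy := invRoot_mul_firstFactor (τ := rho) le_rfl
  have hy0 := firstFactor_ne_zero (τ := rho) le_rfl
  have hdy : den (invRoot rho) * firstFactor rho = 1 :=
    mul_inv_cancel₀ (den_ne_zero (invRoot_eq le_rfl))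
  rw [hx] at hxy hdy
  have hc := critInv_eq'
  refine radius_le_of_critical_boundary_root (N := firstEq) (t := rho)
    -- The `τ`-derivative of `firstEq` at `ρ`, simplified by `ρ² = critInv Q₁(ρ)`. The last factor
    -- has positive real part.
    (c := rho * firstFactor rho ^ 2 * (2 * shift + critInv + 3 * critInv ^ 2 / 2))
    analyticOnNhd_firstEq (norm_pos_iff.2 rho_ne_zero) hp rfl continuousOn_firstFactor
    (fun s hs => firstFactor_eq hs.le) ?_ ?_ ?_
  · set Y := firstFactor rho
    have h1 := (hasDerivAt_pow 3 Y).add ((hasDerivAt_pow 2 Y).const_mul (shift * rho ^ 2 - 1))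
    have h2 := (((hasDerivAt_id Y).const_mul (rho ^ 4)).div_const 4).add_const (rho ^ 6 / 4)
    have h3 := h1.add h2
    refine HasDerivAt.congr_deriv (f := fun y => firstEq (rho, y)) (h3.congr_of_eventuallyEq
      (Eventually.of_forall fun y => ?_)) ?_
    · simp only [firstEq, Pi.add_apply, id]
      ring
    · push_cast
      rw [show rho ^ 4 = (rho ^ 2) ^ 2 by ring, ← hxy]
      unfold den at hdy
      linear_combination -Y ^ 2 / 4 * hc + 2 * Y * hdy
  · set Y := firstFactor rho
    have h1 := (((hasDerivAt_pow 2 rho).const_mul shift).sub_const 1).mul_const (Y ^ 2)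
    have h2 := ((hasDerivAt_pow 4 rho).mul_const Y).div_const 4
    have h3 := ((h1.const_add (Y ^ 3)).add h2).add ((hasDerivAt_pow 6 rho).div_const 4)
    refine HasDerivAt.congr_deriv (f := fun s => firstEq (s, Y)) h3 ?_
    push_cast
    linear_combination (-rho * Y - 3 * rho * (rho ^ 2 + critInv * Y) / 2) * hxy
  · refine mul_ne_zero (mul_ne_zero rho_ne_zero (pow_ne_zero 2 hy0)) fun h => ?_
    have hp := critInv_pos
    have h3 : ((2 + critInv + 3 * critInv ^ 2 / 2 : ℝ) : ℂ) + ((2 * shiftIm : ℝ) : ℂ) * I = 0 := by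
      rw [← h]
      unfold shift
      push_cast
      ring
    have hr := congrArg re h3
    simp only [add_re, ofReal_re, re_ofReal_mul, I_re, mul_zero, add_zero, zero_re] at hr
    nlinarith

theorem exists_secondFactor_series : ∃ p : FormalMultilinearSeries ℂ ℂ ℂ,
    HasFPowerSeriesOnBall secondFactor p 0 (ENNReal.ofReal ‖rho‖) ∧
      p.radius = ENNReal.ofReal ‖rho‖ := by
  have hp := hasFPowerSeriesOnBall_cauchy continuousOn_secondFactor fun τ hτ =>
    analyticAt_secondFactor hτ.le (ne_of_norm_lt_rho hτ)
  refine ⟨_, hp, le_antisymm ?_ hp.r_le⟩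
  have hle : ‖-rho‖ ≤ ‖rho‖ := by simp
  have hP := critInv_mul_secondFactor_neg_rho
  have hder := hasDerivAt_secondEq (-rho) (secondFactor (-rho))
  rw [deriv_secondEq_eq_zero hP (secondFactor_spec hle).2] at hder
  refine radius_le_of_critical_boundary_root (N := secondEq) (t := -rho)
    analyticOnNhd_secondEq (norm_pos_iff.2 rho_ne_zero) hp (norm_neg _) continuousOn_secondFactor
    (fun s hs => (secondFactor_spec hs.le).2) hder (hasDerivAt_secondEq_fst _ _) ?_
  have hX := secondFactor_ne_zero hle
  set X := secondFactor (-rho)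
  have hPc : -rho * X = ((2 / critInv : ℝ) : ℂ) := by
    push_cast
    rw [eq_div_iff critInv_ne_zero]
    linear_combination hP
  have hpos : 0 < 2 / critInv := div_pos two_pos critInv_pos
  intro h
  have h1 : X * (1 / 2 + 2 * shift * (-rho * X) + 3 * (-rho * X) ^ 2 / 2) = 0 := by
    linear_combination h
  have h2 := (mul_eq_zero.1 h1).resolve_left hX
  rw [hPc] at h2
  set P := 2 / critInv
  have h3 : ((1 / 2 + 2 * P + 3 * P ^ 2 / 2 : ℝ) : ℂ) + ((2 * shiftIm * P : ℝ) : ℂ) * I = 0 := by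
    rw [← h2]
    unfold shift
    push_cast
    ring
  have hr := congrArg re h3
  simp only [add_re, ofReal_re, re_ofReal_mul, I_re, mul_zero, add_zero, zero_re] at hr
  nlinarith

/-! ### Saddle points and ramification points -/

theorem eval_saddlePoly (τ u : ℂ) : (saddlePoly τ).eval (I * u)
    = -I * (u ^ 3 + (shift - 1 / τ ^ 2) * u ^ 2 + u / 4 + 1 / 4) := by
  simp only [saddlePoly, eval_add, eval_sub, eval_mul, eval_pow, eval_X, eval_C, shift_eq]
  linear_combination (u ^ 3 * I + (I - 1 / (4 * (Real.pi : ℂ)) - I / τ ^ 2) * u ^ 2) * I_sq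
    + u ^ 2 / (4 * (Real.pi : ℂ)) * I_sq

theorem eval_derivative_saddlePoly (τ u : ℂ) : (saddlePoly τ).derivative.eval (I * u)
    = -(3 * u ^ 2 + 2 * (shift - 1 / τ ^ 2) * u + 1 / 4) := by
  simp [saddlePoly, shift_eq]
  ring_nf
  simp only [I_sq]
  ring

theorem isRoot_first {τ : ℂ} (hτ0 : τ ≠ 0) (hτ : ‖τ‖ ≤ ‖rho‖) :
    (saddlePoly τ).IsRoot (I / τ ^ 2 * firstFactor τ) := by
  rw [IsRoot.def, show I / τ ^ 2 * firstFactor τ = I * (firstFactor τ / τ ^ 2) by ring,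
    eval_saddlePoly]
  have h := firstFactor_eq hτ
  refine mul_eq_zero_of_right _ ?_
  field_simp
  linear_combination 4 * h

theorem isRoot_second {τ : ℂ} (hτ0 : τ ≠ 0) (hτ : ‖τ‖ ≤ ‖rho‖) :
    (saddlePoly τ).IsRoot (I * τ / 2 * secondFactor τ) := by
  rw [IsRoot.def, show I * τ / 2 * secondFactor τ = I * (τ / 2 * secondFactor τ) by ring,
    eval_saddlePoly]
  have h := (secondFactor_spec hτ).2
  unfold secondEq at h
  refine mul_eq_zero_of_right _ ?_
  field_simp
  linear_combination 8 * h

theorem sq_ne_of_norm_le {τ : ℂ} (hτ : ‖τ‖ ≤ ‖rho‖) : τ ^ 2 ≠ -4 * (Real.pi : ℂ) * I := by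
  intro h
  have h1 := congrArg norm h
  rw [norm_pow, norm_mul, norm_mul, norm_neg, RCLike.norm_ofNat, norm_real, norm_I,
    Real.norm_of_nonneg Real.pi_pos.le] at h1
  have := norm_rho_bounds.2
  nlinarith [Real.pi_gt_three, norm_nonneg τ]

theorem isRamificationPoint_rho : IsRamificationPoint rho := by
  have hw : 1 / rho ^ 2 = critVal := by
    rw [div_eq_iff (pow_ne_zero 2 rho_ne_zero)]
    linear_combination -rho_sq_mul
  have hc := critInv_ne_zero
  have hd := den_critInv
  refine ⟨rho_ne_zero, I * (critInv : ℂ)⁻¹, ?_, ?_⟩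
  · rw [IsRoot.def, eval_saddlePoly, hw]
    refine mul_eq_zero_of_right _ ?_
    unfold den at hd
    field_simp
    linear_combination 4 * hd
  · rw [IsRoot.def, eval_derivative_saddlePoly, hw, neg_eq_zero]
    have hs : shift - critVal = -((critInv : ℂ) / 2 + 3 * (critInv : ℂ) ^ 2 / 4) := by
      simp only [shift, critVal, critRe]
      push_cast
      ring
    rw [hs]
    field_simp
    linear_combination -3 * critInv_eq'

/-- Eliminating `w = 1/ρ²` leaves `u³ = u/4 + 1/2`, the reciprocal form of the equation of
`critInv`. Its real root `v` gives `±rho`; the other two give `|w| ≤ 2.4 < 2.48 ≤ |critVal|`. -/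
theorem eq_or_norm_lt_of_ramification {ρ : ℂ} (h : IsRamificationPoint ρ) :
    ρ = rho ∨ ρ = -rho ∨ ‖rho‖ < ‖ρ‖ := by
  obtain ⟨hρ, z, h1, h2⟩ := h
  obtain ⟨u, rfl⟩ : ∃ u, z = I * u := ⟨-I * z, by linear_combination z * I_sq⟩
  rw [IsRoot.def, eval_saddlePoly, neg_mul, neg_eq_zero, mul_eq_zero_iff_left I_ne_zero] at h1
  rw [IsRoot.def, eval_derivative_saddlePoly, neg_eq_zero] at h2
  have hw : ρ ^ 2 * (1 / ρ ^ 2) = 1 := mul_one_div_cancel (pow_ne_zero 2 hρ)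
  set w := 1 / ρ ^ 2
  have hu3 : u ^ 3 = u / 4 + 1 / 2 := by linear_combination u * h2 - 2 * h1
  have hu0 : u ≠ 0 := by
    rintro rfl
    norm_num at h2
  have hwu : w = shift + 3 * u / 2 + u ^ 2 / 4 - 1 / 16 := by
    apply mul_left_cancel₀ hu0
    linear_combination -h2 / 2 - hu3 / 4
  have hc := critInv_ne_zero
  have hce := critInv_eq'
  -- This is `1/critInv`, written without a quotient.
  set v : ℝ := critInv / 4 + critInv ^ 2 / 2 with hv
  have hvc : (critInv : ℂ) * v = 1 := by
    rw [hv]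
    push_cast
    linear_combination hce / 4
  have hv3 : (v : ℂ) ^ 3 = v / 4 + 1 / 2 := by
    apply mul_left_cancel₀ (pow_ne_zero 3 hc)
    linear_combination ((critInv * v : ℂ) ^ 2 + critInv * v + 1 - (critInv : ℂ) ^ 2 / 4) * hvc
      - hce / 4
  have hvb : 0.898 < v ∧ v < 0.8982 := by
    obtain ⟨b1, b2⟩ := critInv_bounds
    rw [hv]
    constructor <;> nlinarith
  have hprod : (u - v) * (u ^ 2 + v * u + v ^ 2 - 1 / 4) = 0 := by
    linear_combination hu3 - hv3
  rcases mul_eq_zero.1 hprod with h | h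
  · have huv := sub_eq_zero.1 h
    have hwc : w = critVal := by
      rw [hwu, huv]
      simp only [shift, critVal, critRe, hv]
      push_cast
      linear_combination ((critInv : ℂ) / 32 + 1 / 64) * hce
    rw [hwc] at hw
    have h0 : critVal ≠ 0 := right_ne_zero_of_mul (hw ▸ one_ne_zero)
    have hsq : ρ ^ 2 = rho ^ 2 := mul_right_cancel₀ h0 (hw.trans rho_sq_mul.symm)
    rcases sq_eq_sq_iff_eq_or_eq_neg.1 hsq with h | h
    · exact Or.inl h
    · exact Or.inr (Or.inl h)
  · refine Or.inr (Or.inr ?_)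
    have r1 := congrArg re h
    have r2 := congrArg im h
    simp [pow_two] at r1 r2
    -- The remaining roots are not real, so they are conjugate and their product is `|u|²`.
    have hn : ‖u‖ ^ 2 = v ^ 2 - 1 / 4 := by
      rw [← normSq_eq_norm_sq, normSq_apply]
      have : u.im * (2 * u.re + v) = 0 := by linear_combination r2
      rcases mul_eq_zero.1 this with h0 | h0
      · rw [h0] at r1
        nlinarith [sq_nonneg (2 * u.re + v)]
      · linear_combination -r1 + u.re * h0
    have hnu : ‖u‖ ≤ 0.75 := by nlinarith [norm_nonneg u]
    have hwn : ‖w‖ ≤ 2.4 := by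
      rw [hwu]
      have t1 := norm_sub_le (shift + 3 * u / 2 + u ^ 2 / 4) (1 / 16)
      have t2 := norm_add₃_le (a := shift) (b := 3 * u / 2) (c := u ^ 2 / 4)
      have t3 := norm_shift_le
      simp only [norm_div, norm_mul, norm_pow, RCLike.norm_ofNat, norm_one] at t1 t2
      nlinarith [norm_nonneg u]
    have hcn : 2.48 ≤ ‖critVal‖ := by
      have := re_le_norm critVal
      have hre : critVal.re = critRe := by simp [critVal]
      linarith [critRe_bounds.1]
    have e1 := congrArg norm hw
    have e2 := congrArg norm rho_sq_mul
    rw [norm_mul, norm_pow, norm_one] at e1 e2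
    by_contra! hle
    have h5 : ‖ρ‖ ^ 2 ≤ ‖rho‖ ^ 2 := pow_le_pow_left₀ (norm_nonneg _) hle 2
    have h6 : 0 < ‖ρ‖ ^ 2 := by positivity
    nlinarith

/-! ### Asymptotic expansions -/

/-- Applied with `e = Q - T` for a truncated series `T`: subtracting the polynomial equation at `T`
from that at `Q` yields a factor `e`, and the cofactor `D` is nonzero at `0` because the root is
simple. -/
theorem isBigO_pow_of_mul_eq {e D h : ℂ → ℂ} {k : ℕ}
    (heq : ∀ᶠ τ in 𝓝 (0 : ℂ), e τ * D τ = τ ^ k * h τ) (hD : ContinuousAt D 0) (hD0 : D 0 ≠ 0)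
    (hh : ContinuousAt h 0) : e =O[𝓝 0] fun τ => τ ^ k := by
  have h1 : (fun τ => h τ / D τ) =O[𝓝 0] fun _ => (1 : ℂ) := (hh.div hD hD0).isBigO_one ℂ
  have h2 := (isBigO_refl (fun τ : ℂ => τ ^ k) (𝓝 0)).mul h1
  simp only [mul_one] at h2
  refine h2.congr' ?_ EventuallyEq.rfl
  filter_upwards [heq, hD.eventually_ne hD0] with τ h1 h2
  rw [mul_div_assoc', ← h1, mul_div_cancel_right₀ _ h2]

theorem eventually_norm_le_rho : ∀ᶠ τ in 𝓝 (0 : ℂ), ‖τ‖ ≤ ‖rho‖ := by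
  filter_upwards [Metric.closedBall_mem_nhds (0 : ℂ) (norm_pos_iff.2 rho_ne_zero)] with τ hτ
  simpa using hτ

theorem zero_sq_ne_rho_sq : (0 : ℂ) ^ 2 ≠ rho ^ 2 := by
  simpa using (pow_ne_zero 2 rho_ne_zero).symm

theorem continuousAt_firstFactor_zero : ContinuousAt firstFactor 0 :=
  (analyticAt_firstFactor (by simp) zero_sq_ne_rho_sq).continuousAt

theorem continuousAt_secondFactor_zero : ContinuousAt secondFactor 0 :=
  (analyticAt_secondFactor (by simp) (by simpa using rho_ne_zero)).continuousAt

theorem firstFactor_expansion :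
    (fun τ : ℂ => firstFactor τ - (1 - shift * τ ^ 2 - τ ^ 4 / 4 - (1 + shift) / 4 * τ ^ 6))
      =O[𝓝 0] fun τ => τ ^ 7 := by
  have hc := continuousAt_firstFactor_zero
  obtain ⟨c, hcdef⟩ : ∃ c : ℂ, c = (1 + shift) / 4 := ⟨_, rfl⟩
  obtain ⟨W, hW⟩ : ∃ W : ℂ → ℂ, ∀ τ, W τ = 1 / 4 + c * τ ^ 2 := ⟨_, fun _ => rfl⟩
  obtain ⟨V, hV⟩ : ∃ V : ℂ → ℂ, ∀ τ, V τ = shift + τ ^ 2 * (1 / 4 + c * τ ^ 2) :=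
    ⟨_, fun _ => rfl⟩
  obtain ⟨T, hT⟩ : ∃ T : ℂ → ℂ, ∀ τ, T τ = 1 - shift * τ ^ 2 - τ ^ 4 / 4 - c * τ ^ 6 :=
    ⟨_, fun _ => rfl⟩
  have hWc : Continuous W := by rw [funext hW]; fun_prop
  have hVc : Continuous V := by rw [funext hV]; fun_prop
  have hTc : Continuous T := by rw [funext hT]; fun_prop
  rw [← hcdef]
  simp_rw [← hT]
  refine isBigO_pow_of_mul_eq
    (D := fun τ => firstFactor τ ^ 2 + firstFactor τ * T τ + T τ ^ 2
      + (shift * τ ^ 2 - 1) * (firstFactor τ + T τ) + τ ^ 4 / 4)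
    (h := fun τ => -τ * (W τ / 4 - V τ ^ 2 / 4 + 2 * c * V τ - c * τ ^ 2 * V τ ^ 2)) ?_ ?_ ?_ ?_
  · filter_upwards [eventually_norm_le_rho] with τ hτ
    have h := firstFactor_eq hτ
    have hT0 : T τ ^ 3 + (shift * τ ^ 2 - 1) * T τ ^ 2 + τ ^ 4 * T τ / 4 + τ ^ 6 / 4
        = τ ^ 8 * (W τ / 4 - V τ ^ 2 / 4 + 2 * c * V τ - c * τ ^ 2 * V τ ^ 2) := by
      rw [hT, hV, hW, show shift = 4 * c - 1 by rw [hcdef]; ring]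
      ring
    linear_combination h - hT0
  · fun_prop
  · simp [firstFactor_zero, hT]
  · fun_prop

theorem secondFactor_expansion :
    (fun τ : ℂ => secondFactor τ - (1 + τ / 4 + (1 / 32 + shift / 2) * τ ^ 2
      + (1 + shift) / 4 * τ ^ 3)) =O[𝓝 0] fun τ => τ ^ 4 := by
  have hc := continuousAt_secondFactor_zero
  obtain ⟨U, hU⟩ : ∃ U : ℂ → ℂ, ∀ τ, U τ = 1 / 32 + shift / 2 + τ * ((1 + shift) / 4) :=
    ⟨_, fun _ => rfl⟩
  obtain ⟨S, hS⟩ : ∃ S : ℂ → ℂ, ∀ τ, S τ = 1 / 4 + τ * (1 / 32 + shift / 2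
    + τ * ((1 + shift) / 4)) := ⟨_, fun _ => rfl⟩
  obtain ⟨T, hT⟩ : ∃ T : ℂ → ℂ, ∀ τ, T τ = 1 + τ / 4 + (1 / 32 + shift / 2) * τ ^ 2
    + (1 + shift) / 4 * τ ^ 3 := ⟨_, fun _ => rfl⟩
  have hUc : Continuous U := by rw [funext hU]; fun_prop
  have hSc : Continuous S := by rw [funext hS]; fun_prop
  have hTc : Continuous T := by rw [funext hT]; fun_prop
  simp_rw [← hT]
  refine isBigO_pow_of_mul_eq
    (D := fun τ => τ / 2 + shift * τ ^ 2 * (secondFactor τ + T τ)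
      + τ ^ 3 * (secondFactor τ ^ 2 + secondFactor τ * T τ + T τ ^ 2) / 2
      - (secondFactor τ + T τ))
    (h := fun τ => -(shift * (2 * U τ + S τ ^ 2)
      + (3 * S τ + 3 * τ * S τ ^ 2 + τ ^ 2 * S τ ^ 3) / 2 - U τ ^ 2)) ?_ ?_ ?_ ?_
  · filter_upwards [eventually_norm_le_rho] with τ hτ
    have h := (secondFactor_spec hτ).2
    unfold secondEq at h
    have hT0 : 1 + τ * T τ / 2 + shift * τ ^ 2 * T τ ^ 2 + τ ^ 3 * T τ ^ 3 / 2 - T τ ^ 2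
        = τ ^ 4 * (shift * (2 * U τ + S τ ^ 2)
          + (3 * S τ + 3 * τ * S τ ^ 2 + τ ^ 2 * S τ ^ 3) / 2 - U τ ^ 2) := by
      rw [hT, hU, hS]
      ring
    linear_combination h - hT0
  · fun_prop
  · simp [secondFactor_zero, hT]
  · fun_prop

theorem eventually_norm_firstFactor_le_one :
    ∀ᶠ τ : ℝ in 𝓝 0, ‖firstFactor (τ : ℂ)‖ ≤ 1 := by
  have hc := continuousAt_firstFactor_zero
  have h : (fun τ : ℂ => firstFactor τ - (1 - shift * τ ^ 2)) =O[𝓝 0] fun τ => τ ^ 4 := by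
    refine isBigO_pow_of_mul_eq (D := fun τ => firstFactor τ ^ 2)
      (h := fun τ => -(firstFactor τ + τ ^ 2) / 4) ?_ (by fun_prop) ?_ (by fun_prop)
    · filter_upwards [eventually_norm_le_rho] with τ hτ
      linear_combination firstFactor_eq hτ
    · simp [firstFactor_zero]
  obtain ⟨C, hC0, hC⟩ := h.exists_pos
  have ht : Tendsto (fun τ : ℝ => (τ : ℂ)) (𝓝 0) (𝓝 0) := by
    simpa using continuous_ofReal.tendsto 0
  -- The linear gain `τ²` must pay for `shiftIm τ² < 0.08 τ²` and for the error `C τ⁴`.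
  have hs : ∀ᶠ τ : ℝ in 𝓝 0, C * τ ^ 2 < 0.9 := by
    have : ContinuousAt (fun τ : ℝ => C * τ ^ 2) 0 := by fun_prop
    exact this.eventually_lt continuousAt_const (by norm_num)
  have hs1 : ∀ᶠ τ : ℝ in 𝓝 0, τ ^ 2 < 1 := by
    have : ContinuousAt (fun τ : ℝ => τ ^ 2) 0 := by fun_prop
    exact this.eventually_lt continuousAt_const (by norm_num)
  filter_upwards [ht.eventually hC.bound, hs, hs1] with τ h1 h2 h3
  have e : (1 - shift * (τ : ℂ) ^ 2) = ((1 - τ ^ 2 : ℝ) : ℂ) - ((shiftIm * τ ^ 2 : ℝ) : ℂ) * I := by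
    unfold shift
    push_cast
    ring
  have hb := shiftIm_bounds
  have n1 : ‖(1 - shift * (τ : ℂ) ^ 2)‖ ≤ (1 - τ ^ 2) + shiftIm * τ ^ 2 := by
    rw [e]
    refine (norm_sub_le _ _).trans ?_
    rw [norm_mul, norm_I, mul_one, norm_real, norm_real, Real.norm_of_nonneg (by linarith),
      Real.norm_of_nonneg (mul_nonneg (by linarith) (sq_nonneg τ))]
  have n2 := norm_sub_norm_le (firstFactor (τ : ℂ)) (1 - shift * (τ : ℂ) ^ 2)
  rw [norm_pow, norm_real, Real.norm_eq_abs, Even.pow_abs (by decide)] at h1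
  nlinarith [sq_nonneg τ]

theorem eventually_one_le_norm_secondFactor :
    ∀ᶠ τ : ℝ in 𝓝[>] 0, 1 ≤ ‖secondFactor (τ : ℂ)‖ := by
  have hc := continuousAt_secondFactor_zero
  have h : (fun τ : ℂ => secondFactor τ - (1 + τ / 4)) =O[𝓝 0] fun τ => τ ^ 2 := by
    -- Completing the square: `e D = (Q₂ - τ/4)² - 1`.
    refine isBigO_pow_of_mul_eq (D := fun τ => secondFactor τ + 1 - τ / 4)
      (h := fun τ => shift * secondFactor τ ^ 2 + τ * secondFactor τ ^ 3 / 2 + 1 / 16)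
      ?_ (by fun_prop) ?_ (by fun_prop)
    · filter_upwards [eventually_norm_le_rho] with τ hτ
      have h := (secondFactor_spec hτ).2
      unfold secondEq at h
      linear_combination -h
    · simp [secondFactor_zero]
  obtain ⟨C, hC0, hC⟩ := h.exists_pos
  have ht : Tendsto (fun τ : ℝ => (τ : ℂ)) (𝓝 0) (𝓝 0) := by
    simpa using continuous_ofReal.tendsto 0
  have hs : ∀ᶠ τ : ℝ in 𝓝 0, C * τ < 1 / 4 := by
    have : ContinuousAt (fun τ : ℝ => C * τ) 0 := by fun_prop
    exact this.eventually_lt continuousAt_const (by norm_num)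
  filter_upwards [nhdsWithin_le_nhds (ht.eventually hC.bound), nhdsWithin_le_nhds hs,
    self_mem_nhdsWithin] with τ h1 h2 h3
  have h3' : 0 < τ := h3
  rw [norm_pow, norm_real, Real.norm_of_nonneg h3'.le] at h1
  have n1 : ‖(1 + (τ : ℂ) / 4)‖ = 1 + τ / 4 := by
    rw [show (1 + (τ : ℂ) / 4) = ((1 + τ / 4 : ℝ) : ℂ) by push_cast; ring, norm_real,
      Real.norm_of_nonneg (by positivity)]
  have n2 := norm_sub_norm_le (1 + (τ : ℂ) / 4) (secondFactor (τ : ℂ))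
  rw [norm_sub_rev, n1] at n2
  nlinarith

theorem eventually_norm_near_one {f : ℂ → ℂ} (hf : ContinuousAt f 0) (h0 : f 0 = 1) {ε : ℝ}
    (hε : 0 < ε) : ∀ᶠ τ : ℝ in 𝓝 0, 1 - ε < ‖f τ‖ ∧ ‖f τ‖ < 1 + ε := by
  have h1 : ContinuousAt (fun τ : ℝ => ‖f τ‖) 0 := by
    refine ContinuousAt.norm (ContinuousAt.comp (g := f) ?_ continuous_ofReal.continuousAt)
    simpa using hf
  have h2 : ‖f ((0 : ℝ) : ℂ)‖ = 1 := by simp [h0]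
  exact (continuousAt_const.eventually_lt h1 (by rw [h2]; linarith)).and
    (h1.eventually_lt continuousAt_const (by rw [h2]; linarith))

theorem mainTheorem7 :
    ∃ ρ₃ : ℂ,
      -- `ρ₃` is the ramification point given numerically to six decimals; `ρ₃` and `-ρ₃` are the
      -- ramification points nearest to the origin
      IsRamificationPoint ρ₃ ∧
      |ρ₃.re - (-0.633938)| < 5 / 10 ^ 7 ∧ |ρ₃.im - 0.010142| < 5 / 10 ^ 7 ∧
      |‖ρ₃‖ - 0.634019| < 5 / 10 ^ 7 ∧
      (∀ ρ : ℂ, IsRamificationPoint ρ → ρ = ρ₃ ∨ ρ = -ρ₃ ∨ ‖ρ₃‖ < ‖ρ‖) ∧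
      ∃ q₁ q₂ Q₁ Q₂ : ℂ → ℂ,
        -- `q₁ τ` and `q₂ τ` are saddle points, expressed through `Q₁` and `Q₂`
        (∀ τ : ℂ, τ ≠ 0 → ‖τ‖ ≤ ‖ρ₃‖ →
          IsSaddlePoint τ (q₁ τ) ∧ (saddlePoly τ).IsRoot (q₁ τ) ∧
          IsSaddlePoint τ (q₂ τ) ∧ (saddlePoly τ).IsRoot (q₂ τ) ∧
          q₁ τ = I / τ ^ 2 * Q₁ τ ∧ q₂ τ = I * τ / 2 * Q₂ τ) ∧
        -- analyticity on the closed disk off the branch points, continuity on the whole of it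
        (∀ τ : ℂ, ‖τ‖ ≤ ‖ρ₃‖ → τ ≠ ρ₃ → τ ≠ -ρ₃ → AnalyticAt ℂ Q₁ τ) ∧
        (∀ τ : ℂ, ‖τ‖ ≤ ‖ρ₃‖ → τ ≠ -ρ₃ → AnalyticAt ℂ Q₂ τ) ∧
        ContinuousOn Q₁ (Metric.closedBall 0 ‖ρ₃‖) ∧
        ContinuousOn Q₂ (Metric.closedBall 0 ‖ρ₃‖) ∧
        -- the disk of convergence of both Taylor series at `0` has radius `‖ρ₃‖`
        (∃ p : FormalMultilinearSeries ℂ ℂ ℂ,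
          HasFPowerSeriesOnBall Q₁ p 0 (ENNReal.ofReal ‖ρ₃‖) ∧
          p.radius = ENNReal.ofReal ‖ρ₃‖) ∧
        (∃ p : FormalMultilinearSeries ℂ ℂ ℂ,
          HasFPowerSeriesOnBall Q₂ p 0 (ENNReal.ofReal ‖ρ₃‖) ∧
          p.radius = ENNReal.ofReal ‖ρ₃‖) ∧
        -- initial terms of the expansions
        (fun τ : ℂ => Q₁ τ - (1 + (-1 - I / (4 * (Real.pi : ℂ))) * τ ^ 2 - τ ^ 4 / 4
            - (8 * (Real.pi : ℂ) + I) * τ ^ 6 / (16 * (Real.pi : ℂ))))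
          =O[𝓝 0] (fun τ : ℂ => τ ^ 7) ∧
        (fun τ : ℂ => Q₂ τ - (1 + τ / 4 + (17 / 32 + I / (8 * (Real.pi : ℂ))) * τ ^ 2
            + (1 / 2 + I / (16 * (Real.pi : ℂ))) * τ ^ 3))
          =O[𝓝 0] (fun τ : ℂ => τ ^ 4) ∧
        -- no zeros on the closed disk
        (∀ τ : ℂ, ‖τ‖ ≤ ‖ρ₃‖ → Q₁ τ ≠ 0 ∧ Q₂ τ ≠ 0) ∧
        -- moduli for small positive `τ`
        (∀ ε : ℝ, 0 < ε → ∃ τ₀ : ℝ, 0 < τ₀ ∧ ∀ τ : ℝ, 0 < τ → τ < τ₀ →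
          1 - ε < ‖Q₁ (τ : ℂ)‖ ∧ ‖Q₁ (τ : ℂ)‖ ≤ 1 ∧
          1 ≤ ‖Q₂ (τ : ℂ)‖ ∧ ‖Q₂ (τ : ℂ)‖ ≤ 1 + ε) := by
  have hsq : ∀ {τ : ℂ}, τ ≠ rho → τ ≠ -rho → τ ^ 2 ≠ rho ^ 2 := by
    intro τ h1 h2 h
    rcases sq_eq_sq_iff_eq_or_eq_neg.1 h with h | h
    · exact h1 h
    · exact h2 h
  refine ⟨rho, isRamificationPoint_rho, ?_, ?_, ?_, fun ρ => eq_or_norm_lt_of_ramification,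
    fun τ => I / τ ^ 2 * firstFactor τ, fun τ => I * τ / 2 * secondFactor τ,
    firstFactor, secondFactor, ?_, ?_, fun τ => analyticAt_secondFactor,
    continuousOn_firstFactor, continuousOn_secondFactor, exists_firstFactor_series,
    exists_secondFactor_series, ?_, ?_,
    fun τ hτ => ⟨firstFactor_ne_zero hτ, secondFactor_ne_zero hτ⟩, ?_⟩
  · obtain ⟨h1, h2⟩ := rho_re_bounds
    rw [abs_lt]
    constructor <;> linarith
  · obtain ⟨h1, h2⟩ := rho_im_bounds
    rw [abs_lt]
    constructor <;> linarith
  · obtain ⟨h1, h2⟩ := norm_rho_bounds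
    rw [abs_lt]
    constructor <;> linarith
  · intro τ hτ0 hτ
    have h1 := isRoot_first hτ0 hτ
    have h2 := isRoot_second hτ0 hτ
    exact ⟨(isSaddlePoint_iff τ _ hτ0 (sq_ne_of_norm_le hτ)).2 h1, h1,
      (isSaddlePoint_iff τ _ hτ0 (sq_ne_of_norm_le hτ)).2 h2, h2, rfl, rfl⟩
  · exact fun τ hτ h1 h2 => analyticAt_firstFactor hτ (hsq h1 h2)
  · refine firstFactor_expansion.congr_left fun τ => ?_
    rw [shift_eq]
    have : (Real.pi : ℂ) ≠ 0 := by exact_mod_cast Real.pi_ne_zero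
    field_simp
    ring
  · refine secondFactor_expansion.congr_left fun τ => ?_
    rw [shift_eq]
    have : (Real.pi : ℂ) ≠ 0 := by exact_mod_cast Real.pi_ne_zero
    field_simp
    ring
  · intro ε hε
    have h := (nhdsWithin_le_nhds (s := Set.Ioi (0 : ℝ)) ((eventually_norm_near_one
      continuousAt_firstFactor_zero firstFactor_zero hε).and ((eventually_norm_near_one
      continuousAt_secondFactor_zero secondFactor_zero hε).and
      eventually_norm_firstFactor_le_one)))
    obtain ⟨τ₀, hτ₀, hsub⟩ := mem_nhdsGT_iff_exists_Ioo_subset.1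
      (inter_mem h eventually_one_le_norm_secondFactor)
    refine ⟨τ₀, hτ₀, fun τ h1 h2 => ?_⟩
    obtain ⟨⟨a1, a2, a3⟩, a4⟩ := hsub ⟨h1, h2⟩
    exact ⟨a1.1, a3, a4, a2.2.le⟩
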